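/- Let $\mathbb C_+=\{x+iy\in\mathbb C: y>0\}$. A growth function is a continuous nondecreasing function from $[0,\infty)$ onto itself. For $q\ge 1$, $\mathscr U^q$ is the set of growth functions $\Phi$ such that $t\mapsto\Phi(t)/t$ is nondecreasing on $(0,\infty)$ and, for some $C>0$, $\Phi(st)\le Ct^q\Phi(s)$ for all $s>0$, $t\ge1$; put $\mathscr U=\bigcup_{q\ge1}\mathscr U^q$. A growth function $\Phi$ belongs to $\tilde{\mathscr U}$ if there is $q\ge 1$ with $\Phi\in\mathscr U^q$ and there are constants $C_1,C_2,C_3>0$ such that - $\Phi(st)\le C_1\Phi(s)\Phi(t)$ for all $s,t>0$; - $\Phi(a/b)\le C_2\,\Phi(a)/b^q$ for all $a,b\ge1$ (with the same $q$); - $\Phi(a/b)\le C_3\,\Phi(a)/\Phi(b)$ for all $0<a\le b\le1$. A function $F:[0,\infty)\to[0,\infty]$ satisfies the $\Delta_2$-condition if, for some $K>1$, $F(2t)\le KF(t)$ for all $t\ge0$. A growth function $\Phi$ satisfies the $\nabla_2$-condition if both $\Phi$ and its complementary function $\Psi(s)=\sup_{t\ge0}\{ts-\Phi(t)\}$ satisfy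 the $\Delta_2$-condition. For $\alpha>-1$ let $dV_\alpha(x+iy)=y^\alpha\,dx\,dy$ on $\mathbb C_+$. The Hardy–Orlicz space $H^{\Phi}(\mathbb C_+)$ is the space of holomorphic $f$ on $\mathbb C_+$ with $$\|f\|_{H^\Phi}^{lux}=\sup_{y>0}\,\inf\Big\{\lambda>0:\int_{\mathbb R}\Phi\Big(\frac{|f(x+iy)|}{\lambda}\Big)dx\le1\Big\}<\infty,$$ and the Bergman–Orlicz space $A^\Phi_\alpha(\mathbb C_+)$ is the space of holomorphic $f$ on $\mathbb C_+$ with $\int_{\mathbb C_+}\Phi(|f|)\,dV_\alpha<\infty$, with the (quasi-)norm $$\|f\|_{\Phi,\alpha}^{lux}=\inf\Big\{\lambda>0:\int_{\mathbb C_+}\Phi\Big(\frac{|f(z)|}{\lambda}\Big)dV_\alpha(z)\le1\Big\}.$$ Let $\mathcal M(H^{\Phi_1}(\mathbb C_+),A_\alpha^{\Phi_2}(\mathbb C_+))$ be the set of holomorphic $g$ on $\mathbb C_+$ for which there is a constant $C>0$ such that, for every $f\in H^{\Phi_1}(\mathbb C_+)$, $fg\in A_\alpha^{\Phi_2}(\mathbb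 C_+)$ and $\|fg\|^{lux}_{\Phi_2,\alpha}\le C\|f\|^{lux}_{H^{\Phi_1}}$. Let $H^\infty(\mathbb C_+)$ be the space of bounded holomorphic functions on $\mathbb C_+$ and, for continuous $\omega:(0,\infty)\to(0,\infty)$, let $H^\infty_\omega(\mathbb C_+)$ be the space of holomorphic $f$ on $\mathbb C_+$ with $\sup_{z\in\mathbb C_+}|f(z)|/\omega(\operatorname{Im}z)<\infty$. **Theorem.** Let $\Phi_1\in\mathscr U$ and $\Phi_2\in\tilde{\mathscr U}$ be such that $\Phi_2/\Phi_1$ is nondecreasing on $(0,\infty)$. Let $\alpha>-1$ and, for $t>0$, put $$\omega(t)=\frac{\Phi_2^{-1}\big(1/t^{2+\alpha}\big)}{\Phi_1^{-1}(1/t)}.$$ 1. If $\Phi_1$ satisfies the $\nabla_2$-condition and there are constants $c,C>0$ with $c\le\omega(t)\le C$ for all $t>0$, then $\mathcal M(H^{\Phi_1}(\mathbb C_+),A_\alpha^{\Phi_2}(\mathbb C_+))=H^\infty(\mathbb C_+)$. 2. If $\omega$ is nondecreasing on $(0,\infty)$ and $\lim_{t\to0}\omega(t)=0$, then $\mathcal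 M(H^{\Phi_1}(\mathbb C_+),A_\alpha^{\Phi_2}(\mathbb C_+))=\{0\}$. 3. If $\Phi_1$ and $\Phi_2\circ\Phi_1^{-1}$ satisfy the $\nabla_2$-condition and $\omega$ is nonincreasing on $(0,\infty)$, then $\mathcal M(H^{\Phi_1}(\mathbb C_+),A_\alpha^{\Phi_2}(\mathbb C_+))=H^\infty_\omega(\mathbb C_+)$. -/

import Mathlib

open Set Filter Topology MeasureTheory
open scoped NNReal ENNReal

namespace OrliczHalfPlane

noncomputable section

/-- A growth function: a continuous nondecreasing function from `[0,∞)` onto itself. -/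
structure IsGrowthFunction (Φ : ℝ≥0 → ℝ≥0) : Prop where
  continuous : Continuous Φ
  monotone : Monotone Φ
  surjective : Function.Surjective Φ

/-- The class of growth functions of upper type `q` (where `q ≥ 1`) for which `Φ(t)/t` is
nondecreasing on `(0,∞)`. -/
structure ClassUq (q : ℝ) (Φ : ℝ≥0 → ℝ≥0) : Prop where
  one_le : 1 ≤ q
  growth : IsGrowthFunction Φ
  upperType : ∃ C : ℝ≥0, 0 < C ∧ ∀ s t : ℝ≥0, 0 < s → 1 ≤ t → Φ (s * t) ≤ C * t ^ q * Φ s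
  monotone_div : MonotoneOn (fun t : ℝ≥0 => Φ t / t) (Ioi 0)

/-- The class `𝒰`, the union over `q ≥ 1` of the classes `ClassUq q`. -/
def ClassU (Φ : ℝ≥0 → ℝ≥0) : Prop := ∃ q : ℝ, ClassUq q Φ

/-- The class `𝒰̃`: the members of some `ClassUq q` which satisfy, with the same `q`, the three
conditions (submultiplicativity, and two reverse conditions for quotients). -/
def ClassUTilde (Φ : ℝ≥0 → ℝ≥0) : Prop :=
  ∃ q : ℝ, ClassUq q Φ ∧
    (∃ C₁ : ℝ≥0, 0 < C₁ ∧ ∀ s t : ℝ≥0, 0 < s → 0 < t → Φ (s * t) ≤ C₁ * Φ s * Φ t) ∧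
    (∃ C₂ : ℝ≥0, 0 < C₂ ∧ ∀ a b : ℝ≥0, 1 ≤ a → 1 ≤ b → Φ (a / b) ≤ C₂ * (Φ a / b ^ q)) ∧
    (∃ C₃ : ℝ≥0, 0 < C₃ ∧
      ∀ a b : ℝ≥0, 0 < a → a ≤ b → b ≤ 1 → Φ (a / b) ≤ C₃ * (Φ a / Φ b))

/-- The complementary function `Ψ(s) = sup_{t ≥ 0} (t s - Φ(t))`. It is `[0,∞]`-valued, so that
the supremum is never a junk value; negative terms may be truncated to `0`, because
the term with `t = 0` is `0` when `Φ(0) = 0`. -/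
def complementary (Φ : ℝ≥0 → ℝ≥0) (s : ℝ≥0) : ℝ≥0∞ :=
  ⨆ t : ℝ≥0, ENNReal.ofReal ((t : ℝ) * s - Φ t)

/-- The `Δ₂`-condition. -/
def Delta2 (F : ℝ≥0 → ℝ≥0∞) : Prop :=
  ∃ K : ℝ≥0, 1 < K ∧ ∀ t : ℝ≥0, F (2 * t) ≤ K * F t

/-- The `∇₂`-condition: the function and its complementary function satisfy the
`Δ₂`-condition. -/
def Nabla2 (Φ : ℝ≥0 → ℝ≥0) : Prop :=
  Delta2 (fun t => (Φ t : ℝ≥0∞)) ∧ Delta2 (complementary Φ)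

/-- The inverse function of a growth function (a genuine two-sided inverse when `Φ` is injective,
in particular for all members of `𝒰`). -/
def inv (Φ : ℝ≥0 → ℝ≥0) : ℝ≥0 → ℝ≥0 := Function.invFun Φ

/-- The open upper half-plane `ℂ₊`. Functions on `ℂ₊` are represented by functions `ℂ → ℂ`, of
which only the values on `ℂ₊` matter in every definition below. -/
def upperHalf : Set ℂ := {z : ℂ | 0 < z.im}

/-- Holomorphy on `ℂ₊`. -/
def Holo (f : ℂ → ℂ) : Prop := DifferentiableOn ℂ f upperHalf

/-- The Luxemburg (quasi-)norm of `f` with respect to a measure, with values in `[0,∞]`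
(the infimum of the empty set is `∞`). -/
def lux {X : Type*} [MeasurableSpace X] (Φ : ℝ≥0 → ℝ≥0) (μ : Measure X) (f : X → ℂ) : ℝ≥0∞ :=
  sInf {r : ℝ≥0∞ | ∃ l : ℝ≥0, 0 < l ∧ r = l ∧ ∫⁻ x, (Φ (‖f x‖₊ / l) : ℝ≥0∞) ∂μ ≤ 1}

/-- The Hardy-Orlicz (quasi-)norm: the supremum over `y > 0` of the Luxemburg norms of
`x ↦ f (x + i y)` on the real line. -/
def hardyNorm (Φ : ℝ≥0 → ℝ≥0) (f : ℂ → ℂ) : ℝ≥0∞ :=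
  ⨆ (y : ℝ) (_ : 0 < y), lux Φ volume (fun x : ℝ => f (x + y * Complex.I))

/-- The Hardy-Orlicz space `H^Φ(ℂ₊)`. -/
def hardySpace (Φ : ℝ≥0 → ℝ≥0) : Set (ℂ → ℂ) := {f | Holo f ∧ hardyNorm Φ f < ∞}

/-- The measure `dV_α(x + i y) = y^α dx dy` on `ℂ₊`. -/
def V (α : ℝ) : Measure ℂ :=
  (volume.restrict upperHalf).withDensity (fun z => ENNReal.ofReal (z.im ^ α))

/-- The Luxemburg (quasi-)norm of the Bergman-Orlicz space. -/
def bergmanNorm (Φ : ℝ≥0 → ℝ≥0) (α : ℝ) (f : ℂ → ℂ) : ℝ≥0∞ := lux Φ (V α) f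

/-- The Bergman-Orlicz space `A_α^Φ(ℂ₊)`. -/
def bergmanSpace (Φ : ℝ≥0 → ℝ≥0) (α : ℝ) : Set (ℂ → ℂ) :=
  {f | Holo f ∧ ∫⁻ z, (Φ ‖f z‖₊ : ℝ≥0∞) ∂(V α) < ∞}

/-- The holomorphic multipliers from the space `X`, with (quasi-)norm `NX`, to the space `Y`,
with (quasi-)norm `NY`. -/
def multipliers (X : Set (ℂ → ℂ)) (NX : (ℂ → ℂ) → ℝ≥0∞)
    (Y : Set (ℂ → ℂ)) (NY : (ℂ → ℂ) → ℝ≥0∞) : Set (ℂ → ℂ) :=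
  {g | Holo g ∧ ∃ C : ℝ≥0, 0 < C ∧
    ∀ f ∈ X, (fun z => f z * g z) ∈ Y ∧ NY (fun z => f z * g z) ≤ C * NX f}

/-- The multipliers from `H^Φ₁(ℂ₊)` to `A_α^Φ₂(ℂ₊)`, for the Luxemburg (quasi-)norms. -/
def hardyBergmanMultipliers (Φ₁ Φ₂ : ℝ≥0 → ℝ≥0) (α : ℝ) : Set (ℂ → ℂ) :=
  multipliers (hardySpace Φ₁) (hardyNorm Φ₁) (bergmanSpace Φ₂ α) (bergmanNorm Φ₂ α)

/-- `H^∞(ℂ₊)`, the bounded holomorphic functions. -/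
def hInfty : Set (ℂ → ℂ) := {f | Holo f ∧ ∃ C : ℝ, ∀ z ∈ upperHalf, ‖f z‖ ≤ C}

/-- The weighted space `H_ω^∞(ℂ₊)`: holomorphic functions with
`sup_{z ∈ ℂ₊} |f(z)| / ω(Im z) < ∞` (for a weight `ω` which is positive on `(0,∞)`). -/
def hInftyWeighted (ω : ℝ≥0 → ℝ≥0) : Set (ℂ → ℂ) :=
  {f | Holo f ∧ ∃ C : ℝ, ∀ z ∈ upperHalf, ‖f z‖ / (ω z.im.toNNReal : ℝ) ≤ C}

/-- The space `{0}`: functions which vanish on `ℂ₊`. -/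
def zeroSpace : Set (ℂ → ℂ) := {f | ∀ z ∈ upperHalf, f z = 0}

/-- The weight `ω(t) = Φ₂⁻¹(1 / t^(2+α)) / Φ₁⁻¹(1 / t)`. -/
def weight (Φ₁ Φ₂ : ℝ≥0 → ℝ≥0) (α : ℝ) (t : ℝ≥0) : ℝ≥0 :=
  inv Φ₂ (1 / t ^ (2 + α)) / inv Φ₁ (1 / t)

end

end OrliczHalfPlane

open OrliczHalfPlane

/-! Necessity. Testing a multiplier `g` on `Φ₁⁻¹(1/v) (v/(z - w̄))²`, with `v = Im w`, whose Hardy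
norm is at most 4, and applying a mean value inequality on the disc of radius `v/2` about `w`, gives
`|g(w)| ≤ K ω(v)` (`exists_nnnorm_le_weight`). This yields the inclusions into `H^∞` and `H^∞_ω`. In
case 2 it makes `g` uniformly small near the real axis and bounded on strips, so the three lines
theorem forces `g = 0`.

Sufficiency. Everything rests on an embedding with a weight `w(y)`
(`setLIntegral_weight_mul_map_half_le`). If `‖f‖ ≤ 1` in `H^{Φ₁}`, Poisson's formula dominates `|f|`
by averages of its values `u` on a horizontal line, and these averages at height `y` are at most
`2τ(y)`, where `τ(y) = Φ₁⁻¹(1/y)`. Hence `Φ₂` may be replaced by its linear continuation beyond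
`τ(y)` before a Jensen-type inequality is used. Integrating in `x` and then in `y` leaves a
one-variable inequality for each value `v` of `u`, which splits at `y = 1/Φ₁(v)` into two integral
tests, `hA` and `hB`. No maximal function is involved.

The `∇₂` hypotheses enter as `G(Lv) ≥ 2L G(v)` for some `L > 1`, which makes the test integrals
geometric series. For bounded `g` the weight is `y^α`. In case 3 it is `1/(y² Φ₂(Φ₁⁻¹(1/y)))`, and
the conditions defining `𝒰̃` compare `y^α Φ₂(s|g|)` with it. -/

namespace OrliczHalfPlane

/-! ### Growth functions, their inverses, and the `∇₂`-condition. -/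

section Growth

variable {Φ : ℝ≥0 → ℝ≥0}

/-- A substitute for Jensen's inequality: if `k(t)/t` is nondecreasing, then `t` is dominated by
an affine function of `k(t)`. -/
theorem mul_le_add_of_monotoneOn_div {k : ℝ≥0 → ℝ≥0}
    (hk : MonotoneOn (fun t => k t / t) (Ioi 0)) {a : ℝ≥0} (ha : 0 < a) (t : ℝ≥0) :
    t * k a ≤ a * k a + a * k t := by
  rcases le_total t a with h | h
  · exact le_add_right (mul_le_mul_left h _)
  · have ht : 0 < t := ha.trans_le h
    have := hk ha ht h
    simp only at this
    rw [div_le_div_iff₀ ha ht] at this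
    calc t * k a = k a * t := mul_comm _ _
      _ ≤ k t * a := this
      _ = a * k t := mul_comm _ _
      _ ≤ _ := le_add_left le_rfl

theorem mul_le_of_monotoneOn_div {k : ℝ≥0 → ℝ≥0}
    (hk : MonotoneOn (fun t => k t / t) (Ioi 0)) (h0 : k 0 = 0) {θ : ℝ≥0} (hθ : θ ≤ 1) (t : ℝ≥0) :
    k (θ * t) ≤ θ * k t := by
  rcases eq_or_ne t 0 with rfl | ht
  · simp [h0]
  rcases eq_or_ne θ 0 with rfl | hθ0
  · simp [h0]
  have ht' : 0 < t := pos_iff_ne_zero.2 ht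
  have hθ' : 0 < θ := pos_iff_ne_zero.2 hθ0
  have := hk (show θ * t ∈ Ioi 0 from mul_pos hθ' ht') ht' (mul_le_of_le_one_left' hθ)
  simp only at this
  rw [div_le_div_iff₀ (mul_pos hθ' ht') ht'] at this
  refine le_of_mul_le_mul_right (this.trans_eq ?_) ht'
  ring

namespace ClassU

theorem growth (hΦ : ClassU Φ) : IsGrowthFunction Φ := hΦ.choose_spec.growth

theorem monotone (hΦ : ClassU Φ) : Monotone Φ := hΦ.growth.monotone

theorem monotone_div (hΦ : ClassU Φ) : MonotoneOn (fun t : ℝ≥0 => Φ t / t) (Ioi 0) :=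
  hΦ.choose_spec.monotone_div

theorem measurable (hΦ : ClassU Φ) : Measurable Φ := hΦ.growth.continuous.measurable

theorem map_zero (hΦ : ClassU Φ) : Φ 0 = 0 := by
  obtain ⟨t, ht⟩ := hΦ.growth.surjective 0
  exact le_antisymm ((hΦ.monotone zero_le).trans_eq ht) zero_le

/-- A zero at `t > 0` would spread by the upper type estimate to all `s ≥ t`, contradicting
surjectivity. -/
theorem map_pos (hΦ : ClassU Φ) {t : ℝ≥0} (ht : 0 < t) : 0 < Φ t := by
  obtain ⟨q, h⟩ := hΦ
  obtain ⟨C, -, hC⟩ := h.upperType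
  by_contra h0
  have h0 : Φ t = 0 := by simpa using h0
  obtain ⟨s, hs⟩ := h.growth.surjective 1
  rcases le_total s t with hst | hst
  · have := h.growth.monotone hst
    rw [hs, h0] at this
    exact absurd this (by norm_num)
  · have := hC t (s / t) ht ((one_le_div ht).2 hst)
    rw [mul_div_cancel₀ _ ht.ne', hs, h0, mul_zero] at this
    exact absurd this (by norm_num)

theorem map_mul_le (hΦ : ClassU Φ) {θ : ℝ≥0} (hθ : θ ≤ 1) (t : ℝ≥0) : Φ (θ * t) ≤ θ * Φ t :=
  mul_le_of_monotoneOn_div hΦ.monotone_div hΦ.map_zero hθ t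

theorem mul_le_map (hΦ : ClassU Φ) {c : ℝ≥0} (hc : 1 ≤ c) (t : ℝ≥0) : c * Φ t ≤ Φ (c * t) := by
  have hc0 : 0 < c := one_pos.trans_le hc
  have := hΦ.map_mul_le (inv_le_one_of_one_le₀ hc) (c * t)
  rw [inv_mul_cancel_left₀ hc0.ne'] at this
  calc c * Φ t ≤ c * (c⁻¹ * Φ (c * t)) := mul_le_mul_right this _
    _ = _ := mul_inv_cancel_left₀ hc0.ne' _

theorem strictMono (hΦ : ClassU Φ) : StrictMono Φ := by
  intro s t hst
  rcases eq_or_ne s 0 with rfl | hs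
  · rw [hΦ.map_zero]; exact hΦ.map_pos hst
  have hs0 : 0 < s := pos_iff_ne_zero.2 hs
  have ht0 : 0 < t := hs0.trans hst
  have := hΦ.monotone_div hs0 ht0 hst.le
  simp only at this
  rw [div_le_div_iff₀ hs0 ht0] at this
  by_contra h
  have h1 : Φ t * s < Φ s * t :=
    calc Φ t * s ≤ Φ s * s := mul_le_mul_left (not_lt.1 h) _
      _ < Φ s * t := mul_lt_mul_of_pos_left hst (hΦ.map_pos hs0)
  exact absurd this (not_le.2 h1)

theorem exists_map_mul_le (hΦ : ClassU Φ) (c : ℝ≥0) :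
    ∃ C : ℝ≥0, 1 ≤ C ∧ ∀ t, Φ (c * t) ≤ C * Φ t := by
  have hΦ' := hΦ
  obtain ⟨q, h⟩ := hΦ
  obtain ⟨C, -, hC⟩ := h.upperType
  refine ⟨max 1 (C * (max 1 c) ^ q), le_max_left _ _, fun t => ?_⟩
  rcases eq_or_ne t 0 with rfl | ht
  · simp [hΦ'.map_zero]
  calc Φ (c * t) ≤ Φ (t * max 1 c) :=
        h.growth.monotone (by rw [mul_comm]; exact mul_le_mul_right (le_max_right _ _) _)
    _ ≤ C * (max 1 c) ^ q * Φ t := hC t _ (pos_iff_ne_zero.2 ht) (le_max_left _ _)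
    _ ≤ _ := mul_le_mul_left (le_max_right _ _) _

theorem map_inv (hΦ : ClassU Φ) (s : ℝ≥0) : Φ (inv Φ s) = s :=
  Function.rightInverse_invFun hΦ.growth.surjective s

theorem inv_map (hΦ : ClassU Φ) (t : ℝ≥0) : inv Φ (Φ t) = t :=
  Function.leftInverse_invFun hΦ.strictMono.injective t

theorem inv_le_iff (hΦ : ClassU Φ) {s t : ℝ≥0} : inv Φ s ≤ t ↔ s ≤ Φ t := by
  rw [← hΦ.strictMono.le_iff_le, hΦ.map_inv]

theorem le_inv_iff (hΦ : ClassU Φ) {s t : ℝ≥0} : t ≤ inv Φ s ↔ Φ t ≤ s := by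
  rw [← hΦ.strictMono.le_iff_le, hΦ.map_inv]

theorem inv_mono (hΦ : ClassU Φ) : Monotone (inv Φ) := fun s t h => by
  rwa [hΦ.inv_le_iff, hΦ.map_inv]

theorem inv_pos (hΦ : ClassU Φ) {s : ℝ≥0} (hs : 0 < s) : 0 < inv Φ s := by
  rw [pos_iff_ne_zero]
  intro h
  have := hΦ.map_inv s
  rw [h, hΦ.map_zero] at this
  exact hs.ne this

theorem inv_mul_le (hΦ : ClassU Φ) {c : ℝ≥0} (hc : 1 ≤ c) (s : ℝ≥0) :
    inv Φ (c * s) ≤ c * inv Φ s := by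
  rw [hΦ.inv_le_iff]
  exact (by rw [hΦ.map_inv] : c * s = c * Φ (inv Φ s)).trans_le (hΦ.mul_le_map hc _)

end ClassU

theorem ClassUTilde.classU (hΦ : ClassUTilde Φ) : ClassU Φ := ⟨_, hΦ.choose_spec.1⟩

/-- The `Δ₂`-condition on the complementary function forces `G(t)/t` to grow like a power. -/
theorem exists_two_mul_le_of_delta2_complementary {G : ℝ≥0 → ℝ≥0}
    (hG : MonotoneOn (fun t => G t / t) (Ioi 0)) (hd : Delta2 (complementary G)) :
    ∃ L : ℝ≥0, 1 < L ∧ ∀ v, 0 < v → 2 * L * G v ≤ G (L * v) := by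
  obtain ⟨K, hK, hd⟩ := hd
  -- Let `a = G v / v`. Terms with `t ≥ v` contribute nothing to the complementary function at `a`,
  -- so its value there is at most `v a`. If the claim failed for `L = K²`, testing `t = L v` at
  -- `4a` would give at least `2 a L v`, whereas two applications of `Δ₂` allow only `L v a`.
  refine ⟨K ^ 2, one_lt_pow₀ hK two_ne_zero, fun v hv => ?_⟩
  by_contra hlt
  rw [not_le] at hlt
  have hGv : 0 < G v := by
    rw [pos_iff_ne_zero]; intro h; simp [h] at hlt
  set L := K ^ 2 with hL
  set a := G v / v with ha
  have hGa : G v = a * v := by rw [ha, div_mul_cancel₀ _ hv.ne']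
  have hup : complementary G a ≤ ENNReal.ofReal (v * a) := by
    refine iSup_le fun t => ?_
    rcases le_total t v with h | h
    · refine ENNReal.ofReal_le_ofReal ?_
      have h1 : (t : ℝ) * a ≤ v * a := by gcongr
      have h2 : (0 : ℝ) ≤ G t := (G t).2
      linarith
    · have ht : 0 < t := hv.trans_le h
      have := hG hv ht h
      simp only at this
      rw [← ha, le_div_iff₀ ht] at this
      have h3 : (a : ℝ) * t ≤ G t := by exact_mod_cast this
      rw [ENNReal.ofReal_of_nonpos (by linarith)]
      exact zero_le
  have hlow : ENNReal.ofReal (2 * a * L * v) ≤ complementary G (2 * (2 * a)) := by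
    refine le_trans (ENNReal.ofReal_le_ofReal ?_)
      (le_iSup (fun t : ℝ≥0 => ENNReal.ofReal ((t : ℝ) * ↑(2 * (2 * a)) - G t)) (L * v))
    have h1 : (G (L * v) : ℝ) ≤ 2 * L * (a * v) := by
      rw [hGa] at hlt; exact_mod_cast hlt.le
    push_cast
    nlinarith
  have h := hlow.trans ((hd _).trans (mul_le_mul_right ((hd a).trans (mul_le_mul_right hup _)) _))
  have e : (K : ℝ≥0∞) * (K * ENNReal.ofReal (v * a)) = ENNReal.ofReal (L * (v * a)) := by
    rw [ENNReal.ofReal_mul (NNReal.coe_nonneg L), ENNReal.ofReal_coe_nnreal, hL]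
    push_cast; ring
  rw [e, ENNReal.ofReal_le_ofReal_iff (by positivity)] at h
  have hpos : (0 : ℝ) < L * (v * a) := by
    have hK0 : 0 < K := one_pos.trans hK
    have : 0 < L * (v * a) := mul_pos (pow_pos hK0 2) (mul_pos hv (div_pos hGv hv))
    exact_mod_cast this
  nlinarith

end Growth

/-! ### Mean value inequalities, Poisson's formula and a three lines argument. -/

section ComplexAnalysis

open Complex

/-- Jensen-type inequality for functions `k` with `k(t)/t` nondecreasing. -/
theorem mul_measure_univ_le_lintegral {X : Type*} [MeasurableSpace X] (μ : Measure X)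
    [IsFiniteMeasure μ] {k : ℝ≥0 → ℝ≥0} (hk : MonotoneOn (fun t => k t / t) (Ioi 0))
    (u : X → ℝ≥0) {a : ℝ≥0} (ha : 0 < a) (h : 2 * a * μ univ ≤ ∫⁻ x, u x ∂μ) :
    k a * μ univ ≤ ∫⁻ x, k (u x) ∂μ := by
  have h1 : (∫⁻ x, (u x : ℝ≥0∞) ∂μ) * k a
      ≤ a * k a * μ univ + a * ∫⁻ x, (k (u x) : ℝ≥0∞) ∂μ := by
    rw [← lintegral_mul_const' _ _ ENNReal.coe_ne_top, ← lintegral_const_mul' _ _ ENNReal.coe_ne_top,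
      ← lintegral_const, ← lintegral_add_left measurable_const]
    refine lintegral_mono fun x => ?_
    have := ENNReal.coe_le_coe.2 (mul_le_add_of_monotoneOn_div hk ha (u x))
    push_cast at this
    exact this
  -- The factor 2 in `h` leaves one copy of `a * k a * μ univ` after the error term is cancelled.
  have h2 : (a : ℝ≥0∞) * k a * μ univ + a * (k a * μ univ)
      ≤ a * k a * μ univ + a * ∫⁻ x, (k (u x) : ℝ≥0∞) ∂μ := by
    refine le_trans (le_of_eq ?_) ((mul_le_mul_left h (k a : ℝ≥0∞)).trans h1)
    ring
  have h3 := (ENNReal.add_le_add_iff_left (by finiteness)).1 h2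
  exact (ENNReal.mul_le_mul_iff_right (by simpa using ha.ne') ENNReal.coe_ne_top).1 h3

theorem norm_circle_le {F : ℂ → ℂ} {c : ℂ} {r : ℝ} (hr : 0 < r)
    (hF : DifferentiableOn ℂ F (Metric.closedBall c r)) :
    ENNReal.ofReal (2 * Real.pi) * ‖F c‖ₑ ≤
      ∫⁻ θ in Ioo (-Real.pi) Real.pi, ‖F (circleMap c r θ)‖ₑ := by
  have hd : DiffContOnCl ℂ F (Metric.ball c |r|) := by
    rw [abs_of_pos hr]
    exact DifferentiableOn.diffContOnCl (by rwa [closure_ball c hr.ne'])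
  have h := hd.circleAverage
  rw [Real.circleAverage_def] at h
  have hper : Function.Periodic (fun θ => F (circleMap c r θ)) (2 * Real.pi) := fun θ => by
    simp only [periodic_circleMap c r θ]
  have h2 := hper.intervalIntegral_add_eq 0 (-Real.pi)
  rw [zero_add, show -Real.pi + 2 * Real.pi = Real.pi by ring] at h2
  rw [h2] at h
  have hpi := Real.pi_pos
  rw [← h, enorm_smul, ← mul_assoc, Real.enorm_of_nonneg (by positivity),
    ← ENNReal.ofReal_mul (by positivity), mul_inv_cancel₀ (by positivity), ENNReal.ofReal_one,
    one_mul, intervalIntegral.integral_of_le (by linarith), integral_Ioc_eq_integral_Ioo]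
  exact enorm_integral_le_lintegral_enorm _

theorem area_mean_value {F : ℂ → ℂ} {c : ℂ} {R : ℝ} (hR : 0 < R)
    (hF : DifferentiableOn ℂ F (Metric.ball c R)) :
    ENNReal.ofReal (Real.pi * R ^ 2) * ‖F c‖ₑ ≤ ∫⁻ z in Metric.ball c R, ‖F z‖ₑ := by
  have hpi := Real.pi_pos
  -- Extension by zero gives a function measurable on the whole plane, to which polar coordinates
  -- about `c` apply.
  set H : ℂ → ℝ≥0∞ := (Metric.ball c R).indicator fun z => ‖F z‖ₑ with hH
  have hHm : Measurable H := by
    classical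
    rw [hH, ← piecewise_eq_indicator]
    exact (hF.continuousOn.enorm).measurable_piecewise continuousOn_const
      Metric.isOpen_ball.measurableSet
  rw [← lintegral_indicator Metric.isOpen_ball.measurableSet, ← hH,
    ← lintegral_add_left_eq_self H c, ← Complex.lintegral_comp_polarCoord_symm]
  have ht : polarCoord.target = Ioi (0 : ℝ) ×ˢ Ioo (-Real.pi) Real.pi := rfl
  rw [ht, Measure.volume_eq_prod, ← Measure.prod_restrict, lintegral_prod]
  swap
  · refine Measurable.aemeasurable ?_
    refine (by fun_prop : Measurable fun p : ℝ × ℝ => ENNReal.ofReal p.1).mul (hHm.comp ?_)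
    have : Measurable (fun p : ℝ × ℝ => Complex.polarCoord.symm p) := by
      simp only [Complex.polarCoord_symm_apply]
      fun_prop
    fun_prop
  have key : ∀ r ∈ Ioo (0 : ℝ) R, ENNReal.ofReal r * (ENNReal.ofReal (2 * Real.pi) * ‖F c‖ₑ) ≤
      ∫⁻ θ in Ioo (-Real.pi) Real.pi, ENNReal.ofReal r * H (c + Complex.polarCoord.symm (r, θ)) := by
    intro r hr
    rw [lintegral_const_mul' _ _ ENNReal.ofReal_ne_top]
    refine mul_le_mul_right ((norm_circle_le hr.1
      (hF.mono (Metric.closedBall_subset_ball hr.2))).trans_eq ?_) _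
    refine lintegral_congr fun θ => ?_
    have e : c + Complex.polarCoord.symm (r, θ) = circleMap c r θ := by
      rw [Complex.polarCoord_symm_apply, circleMap, Complex.exp_mul_I]
      push_cast; rfl
    rw [e, hH, indicator_of_mem]
    rw [Metric.mem_ball, dist_eq_norm, circleMap_sub_center, norm_circleMap_zero, abs_of_pos hr.1]
    exact hr.2
  calc ENNReal.ofReal (Real.pi * R ^ 2) * ‖F c‖ₑ
      = (∫⁻ r in Ioo (0 : ℝ) R, ENNReal.ofReal r) * (ENNReal.ofReal (2 * Real.pi) * ‖F c‖ₑ) := by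
        rw [← mul_assoc]
        congr 1
        rw [← ofReal_integral_eq_lintegral_ofReal, ← integral_Ioc_eq_integral_Ioo,
          ← intervalIntegral.integral_of_le hR.le, integral_id,
          ← ENNReal.ofReal_mul (by rw [zero_pow two_ne_zero, sub_zero]; positivity)]
        · congr 1; ring
        · exact (continuous_id.integrableOn_Icc (a := 0) (b := R)).mono_set Ioo_subset_Icc_self
        · exact (ae_restrict_mem measurableSet_Ioo).mono fun r hr => hr.1.le
    _ = ∫⁻ r in Ioo (0 : ℝ) R, ENNReal.ofReal r * (ENNReal.ofReal (2 * Real.pi) * ‖F c‖ₑ) := by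
        rw [lintegral_mul_const _ (by fun_prop)]
    _ ≤ ∫⁻ r in Ioo (0 : ℝ) R, ∫⁻ θ in Ioo (-Real.pi) Real.pi,
          ENNReal.ofReal r * H (c + Complex.polarCoord.symm (r, θ)) :=
        setLIntegral_mono' measurableSet_Ioo key
    _ ≤ _ := lintegral_mono_set Ioo_subset_Ioi_self

theorem map_half_norm_mul_le {k : ℝ≥0 → ℝ≥0} (hk : MonotoneOn (fun t => k t / t) (Ioi 0))
    (h0 : k 0 = 0) {F : ℂ → ℂ} {c : ℂ} {R : ℝ} (hR : 0 < R)
    (hF : DifferentiableOn ℂ F (Metric.ball c R)) :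
    k (‖F c‖₊ / 2) * ENNReal.ofReal (Real.pi * R ^ 2) ≤ ∫⁻ z in Metric.ball c R, k ‖F z‖₊ := by
  have hvol : volume (Metric.ball c R) = ENNReal.ofReal (Real.pi * R ^ 2) := by
    rw [Complex.volume_ball, mul_comm, ENNReal.ofReal_mul Real.pi_pos.le, ENNReal.ofReal_pow hR.le]
    congr 1
    rw [← NNReal.coe_real_pi, ENNReal.ofReal_coe_nnreal]
  rcases eq_or_ne (F c) 0 with h | h
  · simp [h, h0]
  have : IsFiniteMeasure (volume.restrict (Metric.ball c R)) :=
    ⟨by rw [Measure.restrict_apply_univ, hvol]; exact ENNReal.ofReal_lt_top⟩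
  have := mul_measure_univ_le_lintegral (volume.restrict (Metric.ball c R)) hk (fun z => ‖F z‖₊)
    (a := ‖F c‖₊ / 2) (half_pos (nnnorm_pos.2 h)) ?_
  · rwa [Measure.restrict_apply_univ, hvol] at this
  · rw [Measure.restrict_apply_univ, hvol, mul_comm]
    refine le_trans (le_of_eq ?_) (area_mean_value hR hF)
    congr 1
    rw [ENNReal.coe_div two_ne_zero]
    exact ENNReal.mul_div_cancel two_ne_zero ENNReal.ofNat_ne_top

/-- Cauchy's theorem on the rectangle `[-R, R] × [0, R]`: the three sides off the real axis have
total length `4R`, and the integrand there is at most `C / R²`. -/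
theorem integral_real_eq_zero {G : ℂ → ℂ} (hG : DifferentiableOn ℂ G {z | 0 ≤ z.im})
    (hi : Integrable fun t : ℝ => G t) {C R₀ : ℝ} (hC : ∀ z : ℂ, 0 ≤ z.im → R₀ ≤ ‖z‖ →
      ‖G z‖ ≤ C / ‖z‖ ^ 2) : ∫ t : ℝ, G t = 0 := by
  have h1 := intervalIntegral_tendsto_integral hi tendsto_neg_atTop_atBot tendsto_id
  refine tendsto_nhds_unique h1 ?_
  have hb : ∀ᶠ R : ℝ in atTop, ‖∫ t in (-R)..R, G t‖ ≤ 4 * C / R := by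
    filter_upwards [eventually_ge_atTop R₀, eventually_gt_atTop 0] with R hR hR0
    have hC' : ∀ z : ℂ, 0 ≤ z.im → R ≤ ‖z‖ → ‖G z‖ ≤ C / R ^ 2 := by
      intro z hz hzR
      have := hC z hz (hR.trans hzR)
      have hC0 : 0 ≤ C := by
        have h2 : 0 < ‖z‖ ^ 2 := by have := hR0.trans_le hzR; positivity
        by_contra hneg
        have : C / ‖z‖ ^ 2 < 0 := div_neg_of_neg_of_pos (not_le.1 hneg) h2
        linarith [norm_nonneg (G z)]
      exact this.trans (by gcongr)
    have hrect := integral_boundary_rect_eq_zero_of_differentiableOn G (-R : ℝ) (R + R * I)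
      (hG.mono fun z hz => by
        have := hz.2
        simp [uIcc_of_le hR0.le] at this
        exact this.1)
    simp only [ofReal_re, add_re, mul_re, I_re, mul_zero, ofReal_im, I_im, mul_one, sub_self,
      add_zero, add_im, mul_im, zero_add, ofReal_zero, zero_mul, smul_eq_mul] at hrect
    have top : ‖∫ x : ℝ in -R..R, G (x + R * I)‖ ≤ C / R ^ 2 * |R - -R| :=
      intervalIntegral.norm_integral_le_of_norm_le_const fun x _ => hC' _ (by simp [hR0.le]) <| by
        refine le_trans ?_ (abs_im_le_norm _); simp [le_abs_self]
    have right : ‖∫ y : ℝ in (0:ℝ)..R, G (R + y * I)‖ ≤ C / R ^ 2 * |R - 0| :=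
      intervalIntegral.norm_integral_le_of_norm_le_const fun x hx => hC' _
        (by rw [uIoc_of_le hR0.le] at hx; simpa using hx.1.le) <| by
        refine le_trans ?_ (abs_re_le_norm _); simp [le_abs_self]
    have left : ‖∫ y : ℝ in (0:ℝ)..R, G ((-R : ℝ) + y * I)‖ ≤ C / R ^ 2 * |R - 0| :=
      intervalIntegral.norm_integral_le_of_norm_le_const fun x hx => hC' _
        (by rw [uIoc_of_le hR0.le] at hx; simpa using hx.1.le) <| by
        refine le_trans ?_ (abs_re_le_norm _); simp [le_abs_self]
    have e : ∫ t in (-R)..R, G t = (∫ x : ℝ in -R..R, G (x + R * I))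
        - I * (∫ y : ℝ in (0:ℝ)..R, G (R + y * I))
        + I * (∫ y : ℝ in (0:ℝ)..R, G ((-R : ℝ) + y * I)) := by
      linear_combination hrect
    rw [e]
    refine (norm_add_le _ _).trans ((add_le_add_left (norm_sub_le _ _) _).trans ?_)
    rw [norm_mul, norm_mul, norm_I, one_mul, one_mul]
    rw [show R - -R = 2 * R by ring, abs_of_pos (by positivity)] at top
    rw [sub_zero, abs_of_pos hR0] at left right
    have : 4 * C / R = C / R ^ 2 * (2 * R) + C / R ^ 2 * R + C / R ^ 2 * R := by
      field_simp; ring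
    linarith
  refine squeeze_zero_norm' hb ?_
  exact tendsto_const_nhds.div_atTop tendsto_id

/-- Poisson's formula at the point `i` for bounded holomorphic functions. -/
theorem poisson_at_I {F : ℂ → ℂ} (hF : DifferentiableOn ℂ F {z | 0 ≤ z.im}) {M : ℝ}
    (hM : ∀ z : ℂ, 0 ≤ z.im → ‖F z‖ ≤ M) :
    ∫ t : ℝ, ((Real.pi⁻¹ * (1 + t ^ 2)⁻¹ : ℝ) : ℂ) * F t = F I := by
  have hnhds : {z : ℂ | 0 ≤ z.im} ∈ 𝓝 I :=
    mem_of_superset ((isOpen_lt continuous_const continuous_im).mem_nhds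
      (show (0 : ℝ) < I.im by simp)) fun z (hz : 0 < z.im) => hz.le
  have hcont : Continuous fun t : ℝ => F t :=
    hF.continuousOn.comp_continuous continuous_ofReal fun t => by simp
  have hni : ∀ z : ℂ, 0 ≤ z.im → z + I ≠ 0 := fun z hz h => by
    have := congrArg im h
    simp at this; linarith
  -- This is `(F z - F i) / (z² + 1)` with the singularity at `i` removed. Its integral over the
  -- real line vanishes, which is Poisson's formula at `i`.
  set G : ℂ → ℂ := fun z => dslope F I z / (z + I) with hGdef
  have hG : DifferentiableOn ℂ G {z | 0 ≤ z.im} :=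
    ((differentiableOn_dslope hnhds).2 hF).div (by fun_prop) hni
  have hM0 : 0 ≤ M := (norm_nonneg _).trans (hM I (by simp))
  have hGr : ∀ t : ℝ, G t = ((1 + t ^ 2)⁻¹ : ℝ) * (F t - F I) := by
    intro t
    have hne : (t : ℂ) ≠ I := fun h => by simpa using congrArg im h
    have h1 : (t : ℂ) - I ≠ 0 := sub_ne_zero.2 hne
    have h2 := hni t (by simp)
    have h3 : ((1 + t ^ 2 : ℝ) : ℂ) = (t - I) * (t + I) := by
      push_cast; linear_combination I_sq
    rw [hGdef]
    simp only
    rw [dslope_of_ne _ hne, slope_def_field, ofReal_inv, h3]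
    field_simp
  have hint : ∀ c : ℂ, Integrable fun t : ℝ => ((1 + t ^ 2)⁻¹ : ℝ) * c := fun c =>
    (integrable_inv_one_add_sq.ofReal (𝕜 := ℂ)).mul_const c
  have hintF : Integrable fun t : ℝ => ((1 + t ^ 2)⁻¹ : ℝ) * F t := by
    refine (integrable_inv_one_add_sq.ofReal (𝕜 := ℂ)).mul_bdd (c := M)
      hcont.aestronglyMeasurable (Eventually.of_forall fun t => hM _ (by simp))
  have hGi : Integrable fun t : ℝ => G t := by
    simp_rw [hGr, mul_sub]
    exact hintF.sub (hint _)
  have hdecay : ∀ z : ℂ, 0 ≤ z.im → 2 ≤ ‖z‖ → ‖G z‖ ≤ 8 * M / ‖z‖ ^ 2 := by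
    intro z hz hz2
    have hne : z ≠ I := fun h => by rw [h, norm_I] at hz2; norm_num at hz2
    have h1 : ‖z‖ / 2 ≤ ‖z - I‖ := by
      have := norm_sub_norm_le z I
      rw [norm_I] at this; linarith
    have h2 : ‖z‖ / 2 ≤ ‖z + I‖ := by
      have := norm_sub_norm_le z (-I)
      rw [norm_neg, norm_I, sub_neg_eq_add] at this; linarith
    have h3 : ‖F z - F I‖ ≤ 2 * M := by
      linarith [norm_sub_le (F z) (F I), hM z hz, hM I (by simp)]
    have hz0 : 0 < ‖z‖ / 2 := by linarith
    rw [hGdef]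
    simp only
    rw [dslope_of_ne _ hne, slope_def_field, norm_div, norm_div, div_div]
    calc _ ≤ 2 * M / (‖z‖ / 2 * (‖z‖ / 2)) := by gcongr
      _ = _ := by field_simp; ring
  have h0 := integral_real_eq_zero hG hGi hdecay
  simp_rw [hGr, mul_sub] at h0
  rw [integral_sub hintF (hint _), integral_mul_const, integral_complex_ofReal,
    integral_univ_inv_one_add_sq, sub_eq_zero] at h0
  simp_rw [ofReal_mul, mul_assoc]
  rw [integral_const_mul, h0, ← mul_assoc, ← ofReal_mul,
    inv_mul_cancel₀ Real.pi_ne_zero, ofReal_one, one_mul]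

/-- The map `ζ ↦ x + yζ` carries `i` to `x + iy`, and the Poisson kernel at `i` is the standard
Cauchy density. -/
theorem enorm_le_lintegral_cauchy {F : ℂ → ℂ} (hF : DifferentiableOn ℂ F {z | 0 ≤ z.im}) {M : ℝ}
    (hM : ∀ z : ℂ, 0 ≤ z.im → ‖F z‖ ≤ M) (x : ℝ) {y : ℝ} (hy : 0 < y) :
    ‖F (x + y * I)‖ₑ ≤ ∫⁻ t, ‖F ((x + y * t : ℝ) : ℂ)‖ₑ ∂(ProbabilityTheory.cauchyMeasure 0 1) := by
  have him : ∀ z : ℂ, 0 ≤ z.im → 0 ≤ ((x : ℂ) + y * z).im := fun z hz => by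
    simpa using mul_nonneg hy.le hz
  have h := poisson_at_I (F := fun z => F (x + y * z))
    (hF.comp (by fun_prop : DifferentiableOn ℂ (fun z : ℂ => (x : ℂ) + y * z) _) him)
    (M := M) fun z hz => hM _ (him z hz)
  have hpi := Real.pi_pos
  rw [← h, ProbabilityTheory.cauchyMeasure_of_scale_ne_zero 0 one_ne_zero,
    lintegral_withDensity_eq_lintegral_mul_non_measurable _
      (ProbabilityTheory.measurable_cauchyPDF 0 1)
      (Eventually.of_forall fun _ => ENNReal.ofReal_lt_top)]
  refine (enorm_integral_le_lintegral_enorm _).trans_eq (lintegral_congr fun t => ?_)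
  rw [Pi.mul_apply, enorm_mul, ProbabilityTheory.cauchyPDF_def,
    ProbabilityTheory.cauchyPDFReal_def', ← ofReal_norm (_ : ℂ), norm_real,
    Real.norm_of_nonneg (by positivity)]
  simp

/-- Three lines between the height `l`, where `|g| ≤ ε`, and the height `2 Im z`, where `|g| ≤ B`.
As `Im z` is at most the midpoint of the two shifted by `l/2`, the exponent of `ε` is at least
`1/2`. -/
theorem eq_zero_of_strip_bounds {g : ℂ → ℂ} (hg : Holo g)
    (hb : ∀ h : ℝ, 0 < h → ∃ B : ℝ, ∀ z : ℂ, 0 < z.im → z.im ≤ h → ‖g z‖ ≤ B)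
    (hs : ∀ ε : ℝ, 0 < ε → ∃ h : ℝ, 0 < h ∧ ∀ z : ℂ, 0 < z.im → z.im ≤ h → ‖g z‖ ≤ ε) :
    ∀ z ∈ upperHalf, g z = 0 := by
  intro z hz
  have hz : 0 < z.im := hz
  obtain ⟨B₀, hB₀⟩ := hb (2 * z.im) (by linarith)
  set B := max B₀ 1
  have hB : ∀ w : ℂ, 0 < w.im → w.im ≤ 2 * z.im → ‖g w‖ ≤ B := fun w h1 h2 =>
    (hB₀ w h1 h2).trans (le_max_left _ _)
  have hB1 : 1 ≤ B := le_max_right _ _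
  have key : ∀ ε : ℝ, 0 < ε → ε ≤ 1 → ‖g z‖ ≤ ε ^ (1 / 2 : ℝ) * B := by
    intro ε hε hε1
    obtain ⟨h, hh, hle⟩ := hs ε hε
    set l := min h (z.im / 2)
    have hl : 0 < l := lt_min hh (by linarith)
    have hlz : l ≤ z.im / 2 := min_le_right _ _
    have hmaps : ∀ w : ℂ, (I * w).im = w.re := fun w => by simp
    have h3 := Complex.HadamardThreeLines.norm_le_interp_of_mem_verticalClosedStrip'
      -- Multiplication by `I` turns the vertical strips of the three lines theorem into horizontal
      -- ones.
      (f := fun w => g (I * w)) (z := -I * z) (a := ε) (b := B) (l := l) (u := 2 * z.im)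
      (by linarith) (by
        simp only [HadamardThreeLines.verticalClosedStrip, mem_preimage, mem_Icc]
        simp; constructor <;> linarith)
      (by
        refine DifferentiableOn.diffContOnCl ?_
        refine DifferentiableOn.comp (t := upperHalf) hg (by fun_prop) ?_
        intro w hw
        have hcl : closure (HadamardThreeLines.verticalStrip l (2 * z.im)) ⊆ re ⁻¹' Icc l (2 * z.im) :=
          closure_minimal (preimage_mono Ioo_subset_Icc_self) (isClosed_Icc.preimage continuous_re)
        have := (hcl hw).1
        show 0 < (I * w).im
        rw [hmaps]; linarith)
      (by
        refine ⟨B, ?_⟩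
        rintro _ ⟨w, hw, rfl⟩
        exact hB _ (by rw [hmaps]; linarith [hw.1]) (by rw [hmaps]; exact hw.2))
      (fun w hw => by
        have hw : w.re = l := hw
        exact hle _ (by rw [hmaps, hw]; exact hl) (by rw [hmaps, hw]; exact min_le_left _ _))
      (fun w hw => by
        have hw : w.re = 2 * z.im := hw
        exact hB _ (by rw [hmaps, hw]; linarith) (by rw [hmaps, hw]))
    have e1 : I * (-I * z) = z := by linear_combination -z * I_sq
    have e2 : (-I * z).re = z.im := by simp
    simp only [e1, e2] at h3
    refine h3.trans ?_
    have h4 : 0 < 2 * z.im - l := by linarith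
    refine mul_le_mul ?_ ?_ (by positivity) (by positivity)
    · refine Real.rpow_le_rpow_of_exponent_ge hε hε1 ?_
      rw [le_sub_iff_add_le, ← le_sub_iff_add_le', div_le_iff₀ h4]
      linarith
    · refine Real.rpow_le_self_of_one_le hB1 ?_
      rw [div_le_one h4]; linarith
  have hlim : Tendsto (fun ε : ℝ => ε ^ (1 / 2 : ℝ) * B) (𝓝[>] 0) (𝓝 (0 ^ (1 / 2 : ℝ) * B)) :=
    (((Real.continuous_rpow_const (by norm_num)).tendsto 0).mul_const B).mono_left
      nhdsWithin_le_nhds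
  rw [Real.zero_rpow (by norm_num), zero_mul] at hlim
  have : ‖g z‖ ≤ 0 := ge_of_tendsto hlim (by
    filter_upwards [Ioc_mem_nhdsGT (zero_lt_one' ℝ)] with ε hε
    exact key ε hε.1 hε.2)
  exact norm_le_zero_iff.1 this

end ComplexAnalysis

/-! ### Pointwise bounds for multipliers, and the resulting inclusions. -/

section Necessity

open Complex

variable {Φ Φ₁ Φ₂ : ℝ≥0 → ℝ≥0} {α : ℝ}

theorem lux_le {X : Type*} [MeasurableSpace X] {μ : Measure X} {f : X → ℂ} {l : ℝ≥0} (hl : 0 < l)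
    (h : ∫⁻ x, (Φ (‖f x‖₊ / l) : ℝ≥0∞) ∂μ ≤ 1) : lux Φ μ f ≤ l :=
  sInf_le ⟨l, hl, rfl, h⟩

theorem lintegral_le_one_of_lux_lt (hΦ : Monotone Φ) {X : Type*} [MeasurableSpace X]
    {μ : Measure X} {f : X → ℂ} {l : ℝ≥0} (h : lux Φ μ f < l) :
    ∫⁻ x, (Φ (‖f x‖₊ / l) : ℝ≥0∞) ∂μ ≤ 1 := by
  obtain ⟨r, ⟨m, hm, rfl, hle⟩, hlt⟩ := sInf_lt_iff.1 h
  refine (lintegral_mono fun x => ?_).trans hle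
  have : m ≤ l := (ENNReal.coe_lt_coe.1 hlt).le
  exact ENNReal.coe_le_coe.2 (hΦ (by gcongr))

theorem isOpen_upperHalf : IsOpen upperHalf := isOpen_lt continuous_const continuous_im

theorem measurable_im_rpow (α : ℝ) : Measurable fun z : ℂ => ENNReal.ofReal (z.im ^ α) := by
  fun_prop

theorem lintegral_V (F : ℂ → ℝ≥0∞) :
    ∫⁻ z, F z ∂(V α) = ∫⁻ z in upperHalf, ENNReal.ofReal (z.im ^ α) * F z := by
  rw [V, lintegral_withDensity_eq_lintegral_mul_non_measurable _ (measurable_im_rpow α)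
    (Eventually.of_forall fun _ => ENNReal.ofReal_lt_top)]
  rfl

theorem im_mem_of_mem_ball {w z : ℂ} (hz : z ∈ Metric.ball w (w.im / 2)) :
    w.im / 2 < z.im ∧ z.im < 3 / 2 * w.im := by
  have h1 := (abs_im_le_norm (z - w)).trans_lt (mem_ball_iff_norm.1 hz)
  rw [sub_im, abs_lt] at h1
  constructor <;> linarith

/-- On this ball `Im z` lies between `1/2` and `3/2` times `Im w`. The minimum covers both signs of
`α`. -/
theorem rpow_mul_setLIntegral_ball_le (w : ℂ) (hw : w ∈ upperHalf) (F : ℂ → ℝ≥0∞) :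
    ENNReal.ofReal (min ((1 / 2 : ℝ) ^ α) ((3 / 2) ^ α) * w.im ^ α) *
      ∫⁻ z in Metric.ball w (w.im / 2), F z ≤ ∫⁻ z, F z ∂(V α) := by
  have hw : 0 < w.im := hw
  rw [lintegral_V, ← lintegral_const_mul' _ _ ENNReal.ofReal_ne_top]
  have hsub : Metric.ball w (w.im / 2) ⊆ upperHalf := fun z hz =>
    (by linarith [(im_mem_of_mem_ball hz).1] : 0 < z.im)
  refine le_trans (setLIntegral_mono' Metric.isOpen_ball.measurableSet fun z hz => ?_)
    (lintegral_mono_set hsub)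
  refine mul_le_mul_left (ENNReal.ofReal_le_ofReal ?_) _
  obtain ⟨h1, h2⟩ := im_mem_of_mem_ball hz
  rcases le_total 0 α with h | h
  · calc _ ≤ (1 / 2 : ℝ) ^ α * w.im ^ α := by gcongr; exact min_le_left _ _
      _ = (1 / 2 * w.im) ^ α := (Real.mul_rpow (by norm_num) hw.le).symm
      _ ≤ _ := Real.rpow_le_rpow (by positivity) (by linarith) h
  · calc _ ≤ (3 / 2 : ℝ) ^ α * w.im ^ α := by gcongr; exact min_le_right _ _
      _ = (3 / 2 * w.im) ^ α := (Real.mul_rpow (by norm_num) hw.le).symm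
      _ ≤ _ := Real.rpow_le_rpow_of_nonpos (by linarith) h2.le h

theorem weight_pos (h₁ : ClassU Φ₁) (h₂ : ClassU Φ₂) {t : ℝ≥0} (ht : 0 < t) :
    0 < weight Φ₁ Φ₂ α t :=
  div_pos (h₂.inv_pos (by positivity)) (h₁.inv_pos (by positivity))

/-- The test function concentrated near `w`. -/
noncomputable def testFunction (Φ : ℝ≥0 → ℝ≥0) (w z : ℂ) : ℂ :=
  (inv Φ (1 / w.im.toNNReal) : ℝ) * (w.im / (z - (starRingEnd ℂ) w)) ^ 2

theorem holo_testFunction {w : ℂ} (hw : w ∈ upperHalf) : Holo (testFunction Φ w) := by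
  have hw : 0 < w.im := hw
  have hne : ∀ z ∈ upperHalf, z - (starRingEnd ℂ) w ≠ 0 := fun z hz h => by
    have hz : 0 < z.im := hz
    have := congrArg im h
    simp at this; linarith
  exact (((differentiableOn_const _).div (by fun_prop) hne).pow 2).const_mul _

/-- On each horizontal line the function is at most `θ Φ⁻¹(1/v)` with `θ = v² / ((x - Re w)² + v²) ≤
1`. Since `Φ(t)/t` is nondecreasing, `Φ` of a quarter of this is at most `θ / (4v)`, which lies
below a Cauchy density because `π ≤ 4`. -/
theorem hardyNorm_testFunction_le (hΦ : ClassU Φ) {w : ℂ} (hw : w ∈ upperHalf) :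
    hardyNorm Φ (testFunction Φ w) ≤ (4 : ℝ≥0) := by
  have hw : 0 < w.im := hw
  set v : ℝ≥0 := w.im.toNNReal with hv
  have hv0 : 0 < v := Real.toNNReal_pos.2 hw
  have hvr : (v : ℝ) = w.im := Real.coe_toNNReal _ hw.le
  refine iSup₂_le fun y hy => lux_le (by norm_num) ?_
  have hbound : ∀ x : ℝ, ((Φ (‖testFunction Φ w (x + y * I)‖₊ / 4) : ℝ≥0) : ℝ≥0∞) ≤
      ProbabilityTheory.cauchyPDF w.re v x := by
    intro x
    set D : ℝ := (x - w.re) ^ 2 + v ^ 2 with hD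
    have hD0 : 0 < D := by positivity
    have hθ1 : (v : ℝ) ^ 2 / D ≤ 1 := by rw [div_le_one hD0, hD]; nlinarith [sq_nonneg (x - w.re)]
    set θ : ℝ≥0 := ⟨v ^ 2 / D, by positivity⟩ with hθ
    have hden : D ≤ ‖(x + y * I : ℂ) - (starRingEnd ℂ) w‖ ^ 2 := by
      rw [← normSq_eq_norm_sq, normSq_apply]
      simp [hD, hvr]
      nlinarith
    have hnorm : ‖testFunction Φ w (x + y * I)‖₊ / 4 ≤ θ / 4 * inv Φ (1 / v) := by
      rw [← NNReal.coe_le_coe]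
      push_cast
      rw [testFunction, norm_mul, norm_pow, norm_div, norm_real, norm_real, ← hv,
        Real.norm_of_nonneg (NNReal.coe_nonneg _), Real.norm_of_nonneg hw.le, ← hvr, div_pow]
      have : (v : ℝ) ^ 2 / ‖(x + y * I : ℂ) - (starRingEnd ℂ) w‖ ^ 2 ≤ θ := by
        rw [hθ]; show _ ≤ (v : ℝ) ^ 2 / D
        gcongr
      calc _ ≤ (inv Φ (1 / v) : ℝ) * θ / 4 := by gcongr
        _ = _ := by ring
    have hθ4 : θ / 4 ≤ 1 := by
      rw [← NNReal.coe_le_coe]; push_cast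
      have : (θ : ℝ) ≤ 1 := hθ1
      linarith
    have h1 := (hΦ.monotone hnorm).trans (hΦ.map_mul_le hθ4 _)
    rw [hΦ.map_inv] at h1
    rw [ProbabilityTheory.cauchyPDF_def, ← ENNReal.ofReal_coe_nnreal]
    refine ENNReal.ofReal_le_ofReal ((NNReal.coe_le_coe.2 h1).trans ?_)
    push_cast
    rw [ProbabilityTheory.cauchyPDFReal_def, hθ]
    show (v : ℝ) ^ 2 / D / 4 * (1 / v) ≤ Real.pi⁻¹ * v * D⁻¹
    have hpi := Real.pi_le_four
    have hv' : (0 : ℝ) < v := hv0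
    have h4 : (4 : ℝ)⁻¹ ≤ Real.pi⁻¹ := inv_anti₀ Real.pi_pos hpi
    calc (v : ℝ) ^ 2 / D / 4 * (1 / v) = 4⁻¹ * v * D⁻¹ := by field_simp
      _ ≤ _ := by gcongr
  exact (lintegral_mono hbound).trans (ProbabilityTheory.lintegral_cauchyPDF_eq_one _ hv0.ne').le

theorem exists_nnnorm_le_weight (h₁ : ClassU Φ₁) (h₂ : ClassU Φ₂) {g : ℂ → ℂ}
    (hg : g ∈ hardyBergmanMultipliers Φ₁ Φ₂ α) :
    ∃ K : ℝ≥0, ∀ z ∈ upperHalf, ‖g z‖₊ ≤ K * weight Φ₁ Φ₂ α z.im.toNNReal := by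
  obtain ⟨hgh, C, hC0, hC⟩ := hg
  set cα : ℝ := min ((1 / 2 : ℝ) ^ α) ((3 / 2) ^ α) with hcα
  have hcα0 : 0 < cα := lt_min (by positivity) (by positivity)
  -- Strictly above the bound `4C` for the Bergman norm, so the modular at scale `l` is at most 1.
  set l : ℝ≥0 := C * 4 + 1 with hl
  have hl0 : 0 < l := by positivity
  set K : ℝ≥0 := max 1 (4 / (Real.pi * cα)).toNNReal with hK
  -- The 8 is the factor 2 lost in the mean value inequality times the 4 from the modulus
  -- `Φ₁⁻¹(1/v)/4` of the test function at `w`. `K` absorbs the area and weight constants, and `K ≥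
  -- 1` lets it be pulled out of `Φ₂⁻¹`.
  refine ⟨8 * l * K, fun w hw => ?_⟩
  have hf := holo_testFunction (Φ := Φ₁) hw
  have hn := hardyNorm_testFunction_le h₁ hw
  obtain ⟨-, hB⟩ := hC _ ⟨hf, hn.trans_lt ENNReal.coe_lt_top⟩
  have hlt : bergmanNorm Φ₂ α (fun z => testFunction Φ₁ w z * g z) < l := by
    refine (hB.trans (mul_le_mul_right hn _)).trans_lt ?_
    rw [← ENNReal.coe_mul, ENNReal.coe_lt_coe, hl]
    exact lt_add_one _
  have hint := lintegral_le_one_of_lux_lt h₂.monotone hlt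
  have hw0 : 0 < w.im := hw
  set v : ℝ≥0 := w.im.toNNReal with hv
  have hv0 : 0 < v := Real.toNNReal_pos.2 hw0
  have hvr : (v : ℝ) = w.im := Real.coe_toNNReal _ hw0.le
  set F : ℂ → ℂ := fun z => testFunction Φ₁ w z * g z / (l : ℝ) with hF
  have hFn : ∀ z, ‖F z‖₊ = ‖testFunction Φ₁ w z * g z‖₊ / l := fun z => by
    rw [hF, nnnorm_div]; congr 1; ext; simp
  have hFd : Holo F := (hf.mul hgh).div_const _
  have hsub : Metric.ball w (w.im / 2) ⊆ upperHalf := fun z hz =>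
    (by linarith [(im_mem_of_mem_ball hz).1] : 0 < z.im)
  have h3 := map_half_norm_mul_le h₂.monotone_div h₂.map_zero (half_pos hw0) (hFd.mono hsub)
  have h4 : (Φ₂ (‖F w‖₊ / 2) : ℝ≥0∞) * ENNReal.ofReal (Real.pi * (w.im / 2) ^ 2) *
      ENNReal.ofReal (cα * w.im ^ α) ≤ 1 := by
    refine (mul_le_mul_left h3 _).trans ?_
    rw [mul_comm]
    refine (rpow_mul_setLIntegral_ball_le w hw _).trans ?_
    simpa only [hFn] using hint
  rw [mul_assoc, ← ENNReal.ofReal_mul (by positivity), ← ENNReal.ofReal_coe_nnreal,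
    ← ENNReal.ofReal_mul (by positivity), ENNReal.ofReal_le_one] at h4
  have h5 : Φ₂ (‖F w‖₊ / 2) ≤ K * (1 / v ^ (2 + α)) := by
    rw [← NNReal.coe_le_coe]
    push_cast
    rw [hvr, Real.rpow_add hw0, mul_one_div, le_div_iff₀ (by positivity)]
    have hKr : 4 / (Real.pi * cα) ≤ K := (Real.le_coe_toNNReal _).trans (by
      exact_mod_cast le_max_right _ _)
    refine le_trans ?_ hKr
    rw [le_div_iff₀ (by positivity)]
    rw [show (2 : ℝ) = ((2 : ℕ) : ℝ) by norm_num, Real.rpow_natCast]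
    nlinarith
  have h6 := (h₂.le_inv_iff.2 h5).trans (h₂.inv_mul_le (le_max_left _ _) _)
  have h7 : ‖testFunction Φ₁ w w‖₊ = inv Φ₁ (1 / v) / 4 := by
    have e : w - (starRingEnd ℂ) w = 2 * w.im * I := by
      apply Complex.ext <;> simp; ring
    rw [testFunction, e, nnnorm_mul, nnnorm_pow, nnnorm_div]
    ext
    simp [← hv]
    have : |w.im| ≠ 0 := abs_ne_zero.2 hw0.ne'
    field_simp
    norm_num
  rw [hFn, nnnorm_mul, h7] at h6
  have hG := h₁.inv_pos (s := 1 / v) (by positivity)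
  rw [weight, ← mul_div_assoc, le_div_iff₀ hG]
  calc ‖g w‖₊ * inv Φ₁ (1 / v) = 8 * l * (inv Φ₁ (1 / v) / 4 * ‖g w‖₊ / l / 2) := by
        field_simp; ring
    _ ≤ 8 * l * (K * inv Φ₂ (1 / v ^ (2 + α))) := by gcongr
    _ = _ := by ring

theorem multipliers_subset_hInfty (h₁ : ClassU Φ₁) (h₂ : ClassU Φ₂)
    {C : ℝ≥0} (hC : ∀ t : ℝ≥0, 0 < t → weight Φ₁ Φ₂ α t ≤ C) :
    hardyBergmanMultipliers Φ₁ Φ₂ α ⊆ hInfty := by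
  intro g hg
  obtain ⟨K, hK⟩ := exists_nnnorm_le_weight h₁ h₂ hg
  refine ⟨hg.1, (K * C : ℝ≥0), fun z hz => ?_⟩
  exact_mod_cast (hK z hz).trans (mul_le_mul_right (hC _ (Real.toNNReal_pos.2 hz)) _)

theorem multipliers_subset_hInftyWeighted (h₁ : ClassU Φ₁) (h₂ : ClassU Φ₂) :
    hardyBergmanMultipliers Φ₁ Φ₂ α ⊆ hInftyWeighted (weight Φ₁ Φ₂ α) := by
  intro g hg
  obtain ⟨K, hK⟩ := exists_nnnorm_le_weight h₁ h₂ hg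
  refine ⟨hg.1, K, fun z hz => ?_⟩
  have := weight_pos (α := α) h₁ h₂ (Real.toNNReal_pos.2 hz)
  rw [div_le_iff₀ (by exact_mod_cast this)]
  exact_mod_cast hK z hz

theorem multipliers_subset_zeroSpace (h₁ : ClassU Φ₁) (h₂ : ClassU Φ₂)
    (hm : MonotoneOn (weight Φ₁ Φ₂ α) (Ioi 0))
    (hl : Tendsto (weight Φ₁ Φ₂ α) (𝓝[>] 0) (𝓝 0)) :
    hardyBergmanMultipliers Φ₁ Φ₂ α ⊆ zeroSpace := by
  intro g hg
  obtain ⟨K, hK⟩ := exists_nnnorm_le_weight h₁ h₂ hg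
  have hle : ∀ h : ℝ≥0, 0 < h → ∀ z : ℂ, 0 < z.im → z.im ≤ h →
      ‖g z‖ ≤ (K * weight Φ₁ Φ₂ α h : ℝ≥0) := fun h hh z hz hzh => by
    exact_mod_cast (hK z hz).trans (mul_le_mul_right
      (hm (Real.toNNReal_pos.2 hz) hh (Real.toNNReal_le_iff_le_coe.2 hzh)) _)
  refine eq_zero_of_strip_bounds hg.1 (fun h hh => ?_) fun ε hε => ?_
  · exact ⟨_, fun z hz hzh => hle h.toNNReal (Real.toNNReal_pos.2 hh) z hz
      (by rwa [Real.coe_toNNReal _ hh.le])⟩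
  · have hl' : Tendsto (fun t => K * weight Φ₁ Φ₂ α t) (𝓝[>] 0) (𝓝 0) := by
      simpa using hl.const_mul K
    have hev := hl'.eventually (gt_mem_nhds (Real.toNNReal_pos.2 hε))
    obtain ⟨h, hlt, hh⟩ := (hev.and self_mem_nhdsWithin).exists
    refine ⟨h, by exact_mod_cast hh, fun z hz hzh => (hle h hh z hz hzh).trans ?_⟩
    rw [← Real.coe_toNNReal ε hε.le]
    exact_mod_cast hlt.le

theorem zeroSpace_subset_multipliers (h₂ : ClassU Φ₂) :
    zeroSpace ⊆ hardyBergmanMultipliers Φ₁ Φ₂ α := by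
  intro g hg
  have hg0 : Holo g := (differentiableOn_const (0 : ℂ)).congr hg
  have hint : ∀ (f : ℂ → ℂ) (l : ℝ≥0), ∫⁻ z, (Φ₂ (‖f z * g z‖₊ / l) : ℝ≥0∞) ∂(V α) = 0 := by
    intro f l
    rw [lintegral_V, setLIntegral_congr_fun (g := fun _ => 0) isOpen_upperHalf.measurableSet]
    · simp
    · intro z hz
      simp [hg z hz, h₂.map_zero]
  refine ⟨hg0, 1, one_pos, fun f hf => ⟨⟨hf.1.mul hg0, ?_⟩, ?_⟩⟩
  · have := hint f 1
    simp only [div_one] at this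
    rw [this]; exact ENNReal.zero_lt_top
  · refine le_trans (ENNReal.le_of_forall_pos_le_add fun ε hε _ => ?_) (zero_le (a := _))
    rw [zero_add]
    exact lux_le hε (by rw [hint]; exact zero_le)

end Necessity

/-! ### The weighted embedding of the Hardy–Orlicz space. -/

section Embedding

open Complex

variable {Φ Φ₁ Φ₂ : ℝ≥0 → ℝ≥0}

theorem setLIntegral_im_preimage {H : ℂ → ℝ≥0∞} (hH : Measurable H) {S : Set ℝ}
    (hS : MeasurableSet S) :
    ∫⁻ z in im ⁻¹' S, H z = ∫⁻ y in S, ∫⁻ x : ℝ, H (x + y * I) := by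
  have hS' : MeasurableSet (im ⁻¹' S) := measurable_im hS
  rw [← lintegral_indicator hS', ← lintegral_indicator hS,
    ← (volume_preserving_equiv_real_prod.symm).lintegral_comp_emb
      measurableEquivRealProd.symm.measurableEmbedding, Measure.volume_eq_prod,
    lintegral_prod_symm' (fun p => (im ⁻¹' S).indicator H (measurableEquivRealProd.symm p)) ((hH.indicator hS').comp measurableEquivRealProd.symm.measurable)]
  refine lintegral_congr fun y => ?_
  have e : ∀ x : ℝ, measurableEquivRealProd.symm (x, y) = x + y * I := fun x => by
    rw [measurableEquivRealProd_symm_apply]; exact mk_eq_add_mul_I x y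
  by_cases hy : y ∈ S
  · rw [indicator_of_mem hy]
    refine lintegral_congr fun x => ?_
    rw [e, indicator_of_mem (by simpa using hy)]
  · rw [indicator_of_notMem hy, ← lintegral_zero (μ := (volume : Measure ℝ))]
    refine lintegral_congr fun x => ?_
    rw [e, indicator_of_notMem (by simpa using hy)]

/-- A function of Hardy-Orlicz type is bounded on half-planes strictly inside `ℂ₊`. -/
theorem exists_bound_of_lintegral_le_one (hΦ : ClassU Φ) {f : ℂ → ℂ} (hm : Measurable f)
    (hf : Holo f) (h1 : ∀ y : ℝ, 0 < y → ∫⁻ x : ℝ, (Φ ‖f (x + y * I)‖₊ : ℝ≥0∞) ≤ 1) {ε : ℝ}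
    (hε : 0 < ε) : ∃ M : ℝ, ∀ z : ℂ, ε ≤ z.im → ‖f z‖ ≤ M := by
  have hpi := Real.pi_pos
  refine ⟨2 * inv Φ (4 / (Real.pi * ε)).toNNReal, fun c hc => ?_⟩
  have hball : Metric.ball c (ε / 2) ⊆ im ⁻¹' Ioo (c.im - ε / 2) (c.im + ε / 2) := fun z hz => by
    have h1 := (abs_im_le_norm (z - c)).trans_lt (mem_ball_iff_norm.1 hz)
    rw [sub_im, abs_lt] at h1
    constructor <;> linarith
  have hsub : Metric.ball c (ε / 2) ⊆ upperHalf := fun z hz => by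
    have := (hball hz).1
    show 0 < z.im
    linarith
  have h2 := map_half_norm_mul_le hΦ.monotone_div hΦ.map_zero (half_pos hε) (hf.mono hsub)
  have h3 : ∫⁻ z in Metric.ball c (ε / 2), (Φ ‖f z‖₊ : ℝ≥0∞) ≤ ENNReal.ofReal ε := by
    refine (lintegral_mono_set hball).trans ?_
    rw [setLIntegral_im_preimage (H := fun z => (Φ ‖f z‖₊ : ℝ≥0∞))
      (hΦ.measurable.comp hm.nnnorm).coe_nnreal_ennreal measurableSet_Ioo]
    refine (setLIntegral_mono' measurableSet_Ioo fun y hy => h1 y (by linarith [hy.1])).trans ?_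
    rw [setLIntegral_one, Real.volume_Ioo]
    exact ENNReal.ofReal_le_ofReal (by linarith)
  have h4 := h2.trans h3
  rw [← ENNReal.ofReal_coe_nnreal, ← ENNReal.ofReal_mul (by positivity),
    ENNReal.ofReal_le_ofReal_iff hε.le] at h4
  have h5 : Φ (‖f c‖₊ / 2) ≤ (4 / (Real.pi * ε)).toNNReal := by
    rw [← NNReal.coe_le_coe]
    refine le_trans ?_ (Real.le_coe_toNNReal _)
    rw [le_div_iff₀ (by positivity)]
    refine le_of_mul_le_mul_right ?_ (show 0 < ε / 4 by positivity)
    nlinarith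
  have h6 := NNReal.coe_le_coe.2 (hΦ.le_inv_iff.2 h5)
  push_cast at h6
  linarith

/-- The function equal to `Φ` on `[0, τ]` and continued linearly after `τ`. -/
noncomputable def truncated (Φ : ℝ≥0 → ℝ≥0) (τ t : ℝ≥0) : ℝ≥0 := t * (Φ (min t τ) / min t τ)

theorem truncated_of_le (h : ClassU Φ) {τ t : ℝ≥0} (ht : t ≤ τ) : truncated Φ τ t = Φ t := by
  rw [truncated, min_eq_left ht]
  rcases eq_or_ne t 0 with rfl | h0
  · simp [h.map_zero]
  · exact mul_div_cancel₀ _ h0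

theorem truncated_of_ge {τ t : ℝ≥0} (ht : τ ≤ t) : truncated Φ τ t = t * (Φ τ / τ) := by
  rw [truncated, min_eq_right ht]

theorem monotoneOn_truncated_div (h : ClassU Φ) {τ : ℝ≥0} (hτ : 0 < τ) :
    MonotoneOn (fun t => truncated Φ τ t / t) (Ioi 0) := by
  intro s hs t ht hst
  simp only [truncated]
  rw [mul_div_cancel_left₀ _ (ne_of_gt hs), mul_div_cancel_left₀ _ (ne_of_gt ht)]
  exact h.monotone_div (lt_min hs hτ) (lt_min ht hτ) (min_le_min_right _ hst)

theorem measurable_truncated (h : ClassU Φ) : Measurable fun p : ℝ≥0 × ℝ≥0 =>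
    truncated Φ p.1 p.2 := by
  have := h.measurable
  unfold truncated
  fun_prop

theorem lintegral_cauchy_le {H : ℝ → ℝ≥0∞} (hH : Measurable H) (x : ℝ) {y : ℝ} (hy : 0 < y) :
    ∫⁻ t, H (x + y * t) ∂(ProbabilityTheory.cauchyMeasure 0 1) ≤
      ENNReal.ofReal y⁻¹ * ∫⁻ t, H t := by
  have hpi := Real.pi_gt_three
  rw [ProbabilityTheory.cauchyMeasure_of_scale_ne_zero 0 one_ne_zero,
    lintegral_withDensity_eq_lintegral_mul_non_measurable _
      (ProbabilityTheory.measurable_cauchyPDF 0 1)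
      (Eventually.of_forall fun _ => ENNReal.ofReal_lt_top)]
  have h1 : ∀ t : ℝ, ProbabilityTheory.cauchyPDF 0 1 t ≤ 1 := fun t => by
    rw [ProbabilityTheory.cauchyPDF_def, ENNReal.ofReal_le_one,
      ProbabilityTheory.cauchyPDFReal_def']
    simp only [NNReal.coe_one, inv_one, mul_one, sub_zero, div_one]
    refine mul_le_one₀ (inv_le_one_of_one_le₀ (by linarith)) (by positivity)
      (inv_le_one_of_one_le₀ (by nlinarith))
  calc _ ≤ ∫⁻ t, H (x + y * t) := lintegral_mono fun t => by
        simpa using mul_le_mul_left (h1 t) (H (x + y * t))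
    _ = ∫⁻ t, H (x + t) ∂(volume.map (y * ·)) := by
        rw [lintegral_map (by fun_prop) (by fun_prop)]
    _ = ENNReal.ofReal y⁻¹ * ∫⁻ t, H (x + t) := by
        rw [Real.map_volume_mul_left hy.ne', lintegral_smul_measure,
          abs_of_pos (inv_pos.2 hy)]
        rfl
    _ = _ := by rw [lintegral_add_left_eq_self]

/-- The truncated function still has nondecreasing quotient by `t`, so the Jensen-type inequality
applies to it, and it equals `Φ₂` at `s x / 2`. Translation invariance then removes the average.
Truncation makes the right-hand side only linear in the large values of `u`. -/
theorem lintegral_map_half_le_truncated (h₁ : ClassU Φ₁) (h₂ : ClassU Φ₂) {u : ℝ → ℝ≥0}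
    (hu : Measurable u) (hu1 : ∫⁻ x, (Φ₁ (u x) : ℝ≥0∞) ≤ 1) {s : ℝ → ℝ≥0} {y : ℝ≥0} (hy : 0 < y)
    (hs : ∀ x, (s x : ℝ≥0∞) ≤ ∫⁻ t, u (x + y * t) ∂(ProbabilityTheory.cauchyMeasure 0 1)) :
    ∫⁻ x, (Φ₂ (s x / 2) : ℝ≥0∞) ≤ ∫⁻ x, truncated Φ₂ (inv Φ₁ (1 / y)) (u x) := by
  set τ := inv Φ₁ (1 / y) with hτ
  have hτ0 : 0 < τ := h₁.inv_pos (by positivity)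
  have hΦτ : Φ₁ τ = 1 / y := h₁.map_inv _
  set ν := ProbabilityTheory.cauchyMeasure 0 1
  -- The bound `u ≤ τ + τ y Φ₁(u)` is averaged; since the Cauchy density is at most 1, the average
  -- of `Φ₁(u)` at scale `y` is at most `1/y`.
  have hle : ∀ x, s x ≤ 2 * τ := by
    intro x
    have h1 : ∀ t, u t ≤ τ + τ * y * Φ₁ (u t) := by
      intro t
      have := mul_le_add_of_monotoneOn_div h₁.monotone_div hτ0 (u t)
      rw [hΦτ, mul_one_div, div_le_iff₀ hy] at this
      refine this.trans_eq ?_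
      field_simp
    have h2 : (s x : ℝ≥0∞) ≤ ((2 * τ : ℝ≥0) : ℝ≥0∞) := by
      calc (s x : ℝ≥0∞) ≤ ∫⁻ t, u (x + y * t) ∂ν := hs x
        _ ≤ ∫⁻ t, ((τ : ℝ≥0∞) + (τ * y : ℝ≥0) * Φ₁ (u (x + y * t))) ∂ν :=
            lintegral_mono fun t => by
              have := ENNReal.coe_le_coe.2 (h1 (x + y * t))
              rwa [ENNReal.coe_add, ENNReal.coe_mul (τ * y)] at this
        _ = τ + (τ * y : ℝ≥0) * ∫⁻ t, Φ₁ (u (x + y * t)) ∂ν := by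
            rw [lintegral_add_left measurable_const, lintegral_const, measure_univ, mul_one,
              lintegral_const_mul' _ _ ENNReal.coe_ne_top]
        _ ≤ τ + (τ * y : ℝ≥0) * (ENNReal.ofReal (y : ℝ)⁻¹ * 1) := by
            gcongr
            refine (lintegral_cauchy_le (H := fun t => (Φ₁ (u t) : ℝ≥0∞))
              (h₁.measurable.comp hu).coe_nnreal_ennreal x (NNReal.coe_pos.2 hy)).trans ?_
            gcongr
        _ = ((2 * τ : ℝ≥0) : ℝ≥0∞) := by
            rw [mul_one, ← NNReal.coe_inv, ENNReal.ofReal_coe_nnreal, ← ENNReal.coe_mul,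
              ← ENNReal.coe_add, mul_assoc, mul_inv_cancel₀ hy.ne', mul_one, two_mul]
    exact_mod_cast h2
  have hk := monotoneOn_truncated_div h₂ hτ0
  have hkm : Measurable fun t : ℝ => truncated Φ₂ τ (u t) :=
    (measurable_truncated h₂).comp (measurable_const.prodMk hu)
  calc ∫⁻ x, (Φ₂ (s x / 2) : ℝ≥0∞)
      ≤ ∫⁻ x : ℝ, ∫⁻ t, truncated Φ₂ τ (u (x + y * t)) ∂ν := by
        refine lintegral_mono fun x => ?_
        rcases eq_or_ne (s x) 0 with h0 | h0
        · simp [h0, h₂.map_zero]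
        have := mul_measure_univ_le_lintegral ν hk (fun t => u (x + y * t)) (a := s x / 2)
          (half_pos (pos_iff_ne_zero.2 h0)) (by
            rw [measure_univ, mul_one, ENNReal.coe_div two_ne_zero]
            refine le_trans (le_of_eq ?_) (hs x)
            exact ENNReal.mul_div_cancel two_ne_zero ENNReal.ofNat_ne_top)
        rwa [measure_univ, mul_one, truncated_of_le h₂] at this
        exact (div_le_iff₀' two_pos).2 (hle x)
    _ = ∫⁻ t : ℝ, ∫⁻ x, truncated Φ₂ τ (u (x + y * t)) ∂volume ∂ν := by
        refine lintegral_lintegral_swap (Measurable.aemeasurable ?_)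
        exact (hkm.comp (by fun_prop : Measurable fun p : ℝ × ℝ => p.1 + y * p.2)).coe_nnreal_ennreal
    _ = ∫⁻ t : ℝ, (∫⁻ x, truncated Φ₂ τ (u x)) ∂ν := by
        refine lintegral_congr fun t => ?_
        exact lintegral_add_right_eq_self (fun x => (truncated Φ₂ τ (u x) : ℝ≥0∞)) (y * t)
    _ = _ := by rw [lintegral_const, measure_univ, mul_one]

theorem measurable_inv (h : ClassU Φ) : Measurable (inv Φ) := h.inv_mono.measurable

/-- Since `v ≤ Φ₁⁻¹(1/y)` exactly when `y ≤ 1/Φ₁(v)`, the truncated function is `Φ₂ v` on the first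
range and linear in `v` on the second; `hA` and `hB` bound the two pieces. -/
theorem lintegral_truncated_le (h₁ : ClassU Φ₁) (h₂ : ClassU Φ₂) {w : ℝ → ℝ≥0} {A B : ℝ≥0}
    (hA : ∀ v : ℝ≥0, 0 < v → Φ₂ v * ∫⁻ y in Ioc (0 : ℝ) (1 / Φ₁ v : ℝ≥0), w y ≤ (A * Φ₁ v : ℝ≥0))
    (hB : ∀ v : ℝ≥0, 0 < v → v * ∫⁻ y in Ioi ((1 / Φ₁ v : ℝ≥0) : ℝ),
      (w y * (Φ₂ (inv Φ₁ (1 / y.toNNReal)) / inv Φ₁ (1 / y.toNNReal)) : ℝ≥0) ≤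
        (B * Φ₁ v : ℝ≥0)) (v : ℝ≥0) :
    ∫⁻ y in Ioi (0 : ℝ), w y * truncated Φ₂ (inv Φ₁ (1 / y.toNNReal)) v ≤
      ((A + B) * Φ₁ v : ℝ≥0) := by
  rcases eq_or_ne v 0 with rfl | h0
  · simp [truncated]
  have hv : 0 < v := pos_iff_ne_zero.2 h0
  have hΦ : 0 < Φ₁ v := h₁.map_pos hv
  have hh : (0 : ℝ) ≤ (1 / Φ₁ v : ℝ≥0) := NNReal.coe_nonneg _
  rw [← Ioc_union_Ioi_eq_Ioi hh, add_mul, ENNReal.coe_add]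
  refine (lintegral_union_le _ _ _).trans (add_le_add ?_ ?_)
  · refine le_trans (le_of_eq ?_) (hA v hv)
    rw [← lintegral_const_mul' _ _ ENNReal.coe_ne_top]
    refine setLIntegral_congr_fun measurableSet_Ioc fun y hy => ?_
    have hy0 : 0 < y.toNNReal := Real.toNNReal_pos.2 hy.1
    have hle : v ≤ inv Φ₁ (1 / y.toNNReal) := by
      rw [h₁.le_inv_iff, le_one_div hΦ hy0]
      exact Real.toNNReal_le_iff_le_coe.2 hy.2
    simp only [truncated_of_le h₂ hle]
    rw [mul_comm]
  · refine le_trans (le_of_eq ?_) (hB v hv)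
    rw [← lintegral_const_mul' _ _ ENNReal.coe_ne_top]
    refine setLIntegral_congr_fun measurableSet_Ioi fun y hy => ?_
    have hy' : (1 / Φ₁ v : ℝ≥0) < y.toNNReal := Real.lt_toNNReal_iff_coe_lt.2 hy
    have hy0 : 0 < y.toNNReal := (zero_le).trans_lt hy'
    have hle : inv Φ₁ (1 / y.toNNReal) ≤ v := by
      rw [h₁.inv_le_iff, one_div_le hy0 hΦ]
      exact hy'.le
    simp only [truncated_of_ge hle]
    push_cast
    ring

/-- Embedding of the Hardy-Orlicz space into a weighted Bergman-Orlicz space whose weight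
depends on the imaginary part only. -/
theorem setLIntegral_weight_mul_map_half_le (h₁ : ClassU Φ₁) (h₂ : ClassU Φ₂)
    {w : ℝ → ℝ≥0} (hw : Measurable w) {A B : ℝ≥0}
    (hA : ∀ v : ℝ≥0, 0 < v → Φ₂ v * ∫⁻ y in Ioc (0 : ℝ) (1 / Φ₁ v : ℝ≥0), w y ≤ (A * Φ₁ v : ℝ≥0))
    (hB : ∀ v : ℝ≥0, 0 < v → v * ∫⁻ y in Ioi ((1 / Φ₁ v : ℝ≥0) : ℝ),
      (w y * (Φ₂ (inv Φ₁ (1 / y.toNNReal)) / inv Φ₁ (1 / y.toNNReal)) : ℝ≥0) ≤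
        (B * Φ₁ v : ℝ≥0))
    {f : ℂ → ℂ} (hm : Measurable f) (hf : Holo f)
    (h1 : ∀ y : ℝ, 0 < y → ∫⁻ x : ℝ, (Φ₁ ‖f (x + y * I)‖₊ : ℝ≥0∞) ≤ 1) :
    ∫⁻ z in upperHalf, w z.im * (Φ₂ (‖f z‖₊ / 2) : ℝ≥0∞) ≤ (A + B : ℝ≥0) := by
  -- The shifted function is bounded and holomorphic up to the real axis, as Poisson's formula
  -- requires. Fatou's lemma later removes the shift.
  have hshift : ∀ ε : ℝ, 0 < ε →
      ∫⁻ z in upperHalf, w z.im * (Φ₂ (‖f (z + ε * I)‖₊ / 2) : ℝ≥0∞) ≤ (A + B : ℝ≥0) := by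
    intro ε hε
    set u : ℝ → ℝ≥0 := fun x => ‖f (x + ε * I)‖₊ with hu
    have hum : Measurable u := (hm.comp (by fun_prop)).nnnorm
    obtain ⟨M, hM⟩ := exists_bound_of_lintegral_le_one h₁ hm hf h1 hε
    have hpois := @enorm_le_lintegral_cauchy (fun z => f (z + ε * I))
      (DifferentiableOn.comp (t := upperHalf) hf (by fun_prop) fun z (hz : 0 ≤ z.im) => by
        show 0 < (z + ε * I).im
        simpa using by linarith) M (fun z hz => hM _ (by simpa using hz))
    have hH : Measurable fun z : ℂ => w z.im * (Φ₂ (‖f (z + ε * I)‖₊ / 2) : ℝ≥0∞) :=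
      (hw.comp measurable_im).coe_nnreal_ennreal.mul
        (h₂.measurable.comp ((hm.comp (by fun_prop)).nnnorm.div_const 2)).coe_nnreal_ennreal
    have htr : Measurable fun p : ℝ × ℝ =>
        truncated Φ₂ (inv Φ₁ (1 / p.1.toNNReal)) (u p.2) := by
      exact (measurable_truncated h₂).comp (Measurable.prodMk
        ((measurable_inv h₁).comp (by fun_prop)) (hum.comp measurable_snd))
    calc ∫⁻ z in upperHalf, w z.im * (Φ₂ (‖f (z + ε * I)‖₊ / 2) : ℝ≥0∞)
        = ∫⁻ y in Ioi (0 : ℝ), ∫⁻ x : ℝ, w y * (Φ₂ (‖f (x + y * I + ε * I)‖₊ / 2) : ℝ≥0∞) := by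
          refine (setLIntegral_im_preimage hH measurableSet_Ioi).trans ?_
          simp
      _ ≤ ∫⁻ y in Ioi (0 : ℝ), ∫⁻ x : ℝ,
            w y * (truncated Φ₂ (inv Φ₁ (1 / y.toNNReal)) (u x) : ℝ≥0∞) := by
          refine setLIntegral_mono' measurableSet_Ioi fun y (hy : 0 < y) => ?_
          rw [lintegral_const_mul' _ _ ENNReal.coe_ne_top,
            lintegral_const_mul' _ _ ENNReal.coe_ne_top]
          refine mul_le_mul_right ?_ _
          refine lintegral_map_half_le_truncated h₁ h₂ hum (h1 ε hε) (Real.toNNReal_pos.2 hy)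
            fun x => ?_
          rw [Real.coe_toNNReal _ hy.le]
          exact hpois x hy
      _ = ∫⁻ x : ℝ, ∫⁻ y in Ioi (0 : ℝ),
            w y * (truncated Φ₂ (inv Φ₁ (1 / y.toNNReal)) (u x) : ℝ≥0∞) := by
          refine lintegral_lintegral_swap (Measurable.aemeasurable ?_)
          exact (hw.comp measurable_fst).coe_nnreal_ennreal.mul htr.coe_nnreal_ennreal
      _ ≤ ∫⁻ x : ℝ, ((A + B : ℝ≥0) : ℝ≥0∞) * Φ₁ (u x) :=
          lintegral_mono fun x => by
            simpa using lintegral_truncated_le h₁ h₂ hA hB (u x)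
      _ ≤ (A + B : ℝ≥0) := by
          rw [lintegral_const_mul' _ _ ENNReal.coe_ne_top]
          simpa using mul_le_mul_right (h1 ε hε) ((A + B : ℝ≥0) : ℝ≥0∞)
  set ε : ℕ → ℝ := fun n => 1 / ((n : ℝ) + 1) with hεdef
  have hε0 : ∀ n, 0 < ε n := fun n => Nat.one_div_pos_of_nat
  have hεt : Tendsto ε atTop (𝓝 0) := tendsto_one_div_add_atTop_nhds_zero_nat
  have hmeas : ∀ n, Measurable fun z : ℂ => w z.im * (Φ₂ (‖f (z + ε n * I)‖₊ / 2) : ℝ≥0∞) :=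
    fun n => (hw.comp measurable_im).coe_nnreal_ennreal.mul
        (h₂.measurable.comp ((hm.comp (by fun_prop)).nnnorm.div_const 2)).coe_nnreal_ennreal
  calc ∫⁻ z in upperHalf, w z.im * (Φ₂ (‖f z‖₊ / 2) : ℝ≥0∞)
      = ∫⁻ z in upperHalf,
          liminf (fun n => w z.im * (Φ₂ (‖f (z + ε n * I)‖₊ / 2) : ℝ≥0∞)) atTop := by
        refine setLIntegral_congr_fun isOpen_upperHalf.measurableSet fun z hz => ?_
        refine (Tendsto.liminf_eq ?_).symm
        refine ENNReal.Tendsto.const_mul (ENNReal.tendsto_coe.2 ?_) (Or.inr ENNReal.coe_ne_top)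
        have hc : ContinuousAt f z :=
          (hf.differentiableAt (isOpen_upperHalf.mem_nhds hz)).continuousAt
        have hz' : Tendsto (fun n => z + ε n * I) atTop (𝓝 z) := by
          have : Tendsto (fun n => z + ε n * I) atTop (𝓝 (z + (0 : ℝ) * I)) :=
            (((continuous_ofReal.tendsto 0).comp hεt).mul_const I).const_add z
          simpa using this
        exact (h₂.growth.continuous.tendsto _).comp
          (((continuous_nnnorm.tendsto _).comp (hc.tendsto.comp hz')).div_const 2)
    _ ≤ liminf (fun n => ∫⁻ z in upperHalf,
          w z.im * (Φ₂ (‖f (z + ε n * I)‖₊ / 2) : ℝ≥0∞)) atTop :=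
        lintegral_liminf_le hmeas
    _ ≤ (A + B : ℝ≥0) :=
        liminf_le_of_le (by isBoundedDefault) fun b hb => by
          obtain ⟨n, hn⟩ := hb.exists
          exact hn.trans (hshift _ (hε0 n))

end Embedding

/-! ### The one-variable integral tests. -/

section Integrals

variable {Φ Φ₁ Φ₂ : ℝ≥0 → ℝ≥0} {α : ℝ}

theorem setLIntegral_le_of_geometric {S : Set ℝ} {T : ℕ → Set ℝ} (hT : ∀ k, MeasurableSet (T k))
    (hS : S ⊆ ⋃ k, T k) {F : ℝ → ℝ≥0∞} {c l : ℕ → ℝ≥0} {E : ℝ≥0}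
    (hF : ∀ k, ∀ y ∈ T k, F y ≤ c k) (hl : ∀ k, volume (T k) ≤ l k)
    (hE : ∀ k, c k * l k ≤ E * 2⁻¹ ^ k) : ∫⁻ y in S, F y ≤ (E * 2 : ℝ≥0) := by
  calc ∫⁻ y in S, F y ≤ ∑' k, ∫⁻ y in T k, F y :=
        (lintegral_mono_set hS).trans (lintegral_iUnion_le _ _)
    _ ≤ ∑' k, (E : ℝ≥0∞) * 2⁻¹ ^ k := by
        refine ENNReal.tsum_le_tsum fun k => ?_
        refine (setLIntegral_mono' (hT k) (hF k)).trans ?_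
        rw [setLIntegral_const]
        refine (mul_le_mul_right (hl k) _).trans ?_
        have := ENNReal.coe_le_coe.2 (hE k)
        push_cast at this
        exact this
    _ = (E * 2 : ℝ≥0) := by
        rw [ENNReal.tsum_mul_left, ENNReal.tsum_geometric, ENNReal.one_sub_inv_two, inv_inv]
        push_cast; rfl

/-- With `s = 1/y` this is `∫_V^∞ ds/G(s) ≲ V/G(V)`. On the piece `s ≈ L^k V`, of length comparable
to `L^k V`, `G` is at least `(2L)^k G(V)`, so the pieces decay like `2^{-k}`. -/
theorem lintegral_Ioc_le_of_two_mul_le {G : ℝ≥0 → ℝ≥0}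
    (hG : MonotoneOn (fun t => G t / t) (Ioi 0)) (hpos : ∀ t, 0 < t → 0 < G t) {L : ℝ≥0}
    (hL : 1 < L) (h : ∀ v, 0 < v → 2 * L * G v ≤ G (L * v)) {V : ℝ≥0} (hV : 0 < V) :
    G V * ∫⁻ y in Ioc (0 : ℝ) (1 / V : ℝ≥0), ((1 / (y.toNNReal ^ 2 * G (1 / y.toNNReal)) : ℝ≥0) : ℝ≥0∞)
      ≤ (2 * L * V : ℝ≥0) := by
  have hL0 : 0 < L := one_pos.trans hL
  have hGV := hpos V hV
  have hiter : ∀ k : ℕ, (2 * L) ^ k * G V ≤ G (L ^ k * V) := by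
    intro k
    induction k with
    | zero => simp
    | succ k ih =>
      calc (2 * L) ^ (k + 1) * G V = 2 * L * ((2 * L) ^ k * G V) := by ring
        _ ≤ 2 * L * G (L ^ k * V) := by gcongr
        _ ≤ G (L * (L ^ k * V)) := h _ (by positivity)
        _ = _ := by congr 1; ring
  have hcov : Ioc (0 : ℝ) (1 / V : ℝ≥0) ⊆
      ⋃ k : ℕ, Ioc ((1 / V / L ^ (k + 1) : ℝ≥0) : ℝ) (1 / V / L ^ k : ℝ≥0) := by
    intro y hy
    have hy0 : 0 < y := hy.1
    have hVr : (0 : ℝ) < V := hV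
    have hLr : (0 : ℝ) < L := hL0
    have h1 : (1 : ℝ) ≤ 1 / V / y := by
      rw [one_le_div hy0]; simpa using hy.2
    obtain ⟨n, hn1, hn2⟩ := exists_nat_pow_near h1 (NNReal.one_lt_coe.2 hL)
    refine mem_iUnion.2 ⟨n, ?_, ?_⟩
    · push_cast
      rw [div_lt_iff₀ hy0] at hn2
      rw [div_lt_iff₀ (by positivity), mul_comm]; exact hn2
    · push_cast
      rw [le_div_iff₀ hy0] at hn1
      rw [le_div_iff₀ (by positivity), mul_comm]; exact hn1
  have hmain := setLIntegral_le_of_geometric (fun k => measurableSet_Ioc) hcov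
    (F := fun y => ((1 / (y.toNNReal ^ 2 * G (1 / y.toNNReal)) : ℝ≥0) : ℝ≥0∞))
    (c := fun k => V ^ 2 * L ^ (k + 1) / (2 ^ k * G V)) (l := fun k => 1 / V / L ^ k)
    (E := L * V / G V) ?_ ?_ ?_
  · refine (mul_le_mul_right hmain _).trans (le_of_eq ?_)
    rw [← ENNReal.coe_mul]
    congr 1
    field_simp
  · intro k y hy
    refine ENNReal.coe_le_coe.2 ?_
    set Y := y.toNNReal
    have hY1 : 1 / V / L ^ (k + 1) < Y := Real.lt_toNNReal_iff_coe_lt.2 hy.1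
    have hY2 : Y ≤ 1 / V / L ^ k := Real.toNNReal_le_iff_le_coe.2 hy.2
    have hY0 : 0 < Y := zero_le.trans_lt hY1
    have hle : L ^ k * V ≤ 1 / Y := by
      rw [le_div_iff₀ hY0]
      calc L ^ k * V * Y ≤ L ^ k * V * (1 / V / L ^ k) := by gcongr
        _ = 1 := by field_simp
    have hmono := hG (show L ^ k * V ∈ Ioi 0 by exact mul_pos (pow_pos hL0 _) hV)
      (show 1 / Y ∈ Ioi 0 from by exact one_div_pos.2 hY0) hle
    simp only at hmono
    have h2 : 2 ^ k * G V / V ≤ Y * G (1 / Y) := by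
      calc 2 ^ k * G V / V = (2 * L) ^ k * G V / (L ^ k * V) := by rw [mul_pow]; field_simp
        _ ≤ G (L ^ k * V) / (L ^ k * V) := by gcongr; exact hiter k
        _ ≤ G (1 / Y) / (1 / Y) := hmono
        _ = _ := by field_simp
    calc 1 / (Y ^ 2 * G (1 / Y)) = 1 / (Y * (Y * G (1 / Y))) := by ring_nf
      _ ≤ 1 / (1 / V / L ^ (k + 1) * (2 ^ k * G V / V)) := by gcongr
      _ = _ := by field_simp
  · intro k
    rw [Real.volume_Ioc, ← ENNReal.ofReal_coe_nnreal]
    exact ENNReal.ofReal_le_ofReal (sub_le_self _ (NNReal.coe_nonneg _))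
  · intro k
    refine le_of_eq ?_
    rw [inv_pow]
    field_simp
    exact pow_succ L k

/-- With `s = 1/y` and `V = Φ v` this is `∫_0^V ds/Φ⁻¹(s) ≲ V/v`. The growth hypothesis reads
`Φ⁻¹(2Ls) ≤ L Φ⁻¹(s)`; on pieces of ratio `2L` the length shrinks by `2L` and the integrand grows by
at most `L`, leaving `2^{-k}`. -/
theorem lintegral_Ioi_le_of_two_mul_le (hΦ : ClassU Φ) {L : ℝ≥0} (hL : 1 < L)
    (h : ∀ v, 0 < v → 2 * L * Φ v ≤ Φ (L * v)) {v : ℝ≥0} (hv : 0 < v) :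
    v * ∫⁻ y in Ioi ((1 / Φ v : ℝ≥0) : ℝ),
      ((1 / (y.toNNReal ^ 2 * inv Φ (1 / y.toNNReal)) : ℝ≥0) : ℝ≥0∞) ≤ (4 * L ^ 2 * Φ v : ℝ≥0) := by
  have hL0 : 0 < L := one_pos.trans hL
  set V := Φ v with hVdef
  have hV : 0 < V := hΦ.map_pos hv
  set N := 2 * L with hN
  have hN1 : 1 < N := one_lt_mul_of_le_of_lt one_le_two hL
  have hN0 : 0 < N := one_pos.trans hN1
  have hstep : ∀ s, 0 < s → inv Φ (N * s) ≤ L * inv Φ s := fun s hs => by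
    rw [hΦ.inv_le_iff]
    have := h _ (hΦ.inv_pos hs)
    rwa [hΦ.map_inv] at this
  have hiter : ∀ k : ℕ, ∀ s, 0 < s → inv Φ (N ^ k * s) ≤ L ^ k * inv Φ s := by
    intro k s hs
    induction k with
    | zero => simp
    | succ k ih =>
      calc inv Φ (N ^ (k + 1) * s) = inv Φ (N * (N ^ k * s)) := by congr 1; ring
        _ ≤ L * inv Φ (N ^ k * s) := hstep _ (by positivity)
        _ ≤ L * (L ^ k * inv Φ s) := by gcongr
        _ = _ := by ring
  have hcov : Ioi ((1 / V : ℝ≥0) : ℝ) ⊆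
      ⋃ k : ℕ, Ico ((N ^ k / V : ℝ≥0) : ℝ) (N ^ (k + 1) / V : ℝ≥0) := by
    intro y hy
    have hVr : (0 : ℝ) < V := hV
    have h1 : (1 : ℝ) ≤ y * V := by
      have : ((1 / V : ℝ≥0) : ℝ) < y := hy
      push_cast at this
      rw [div_lt_iff₀ hVr] at this
      exact this.le
    obtain ⟨n, hn1, hn2⟩ := exists_nat_pow_near h1 (NNReal.one_lt_coe.2 hN1)
    refine mem_iUnion.2 ⟨n, ?_, ?_⟩
    · rw [NNReal.coe_div, NNReal.coe_pow]
      exact (div_le_iff₀ hVr).2 hn1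
    · rw [NNReal.coe_div, NNReal.coe_pow]
      exact (lt_div_iff₀ hVr).2 hn2
  have hmain := setLIntegral_le_of_geometric (fun k => measurableSet_Ico) hcov
    (F := fun y => ((1 / (y.toNNReal ^ 2 * inv Φ (1 / y.toNNReal)) : ℝ≥0) : ℝ≥0∞))
    (c := fun k => V ^ 2 * L ^ (k + 1) / (N ^ (2 * k) * v)) (l := fun k => N ^ (k + 1) / V)
    (E := L * N * V / v) ?_ ?_ ?_
  · refine (mul_le_mul_right hmain _).trans (le_of_eq ?_)
    rw [← ENNReal.coe_mul]
    congr 1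
    rw [hN]
    field_simp
    ring
  · intro k y hy
    refine ENNReal.coe_le_coe.2 ?_
    set Y := y.toNNReal
    have hY1 : N ^ k / V ≤ Y := NNReal.le_toNNReal_of_coe_le hy.1
    have hY0 : 0 < Y := (div_pos (pow_pos hN0 _) hV).trans_le hY1
    have hY2 : Y ≤ N ^ (k + 1) / V := Real.toNNReal_le_iff_le_coe.2 hy.2.le
    have h1 : v ≤ L ^ (k + 1) * inv Φ (1 / Y) := by
      have e : v = inv Φ V := (hΦ.inv_map v).symm
      calc v = inv Φ V := e
        _ ≤ inv Φ (N ^ (k + 1) * (1 / Y)) := hΦ.inv_mono (by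
            rw [mul_one_div, le_div_iff₀ hY0, mul_comm, ← le_div_iff₀ hV]; exact hY2)
        _ ≤ _ := hiter _ _ (one_div_pos.2 hY0)
    calc 1 / (Y ^ 2 * inv Φ (1 / Y)) ≤ 1 / ((N ^ k / V) ^ 2 * (v / L ^ (k + 1))) := by
          gcongr
          rw [div_le_iff₀ (by positivity), mul_comm]
          exact h1
      _ = _ := by rw [pow_mul', div_pow]; field_simp
  · intro k
    rw [Real.volume_Ico, ← ENNReal.ofReal_coe_nnreal]
    exact ENNReal.ofReal_le_ofReal (sub_le_self _ (NNReal.coe_nonneg _))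
  · intro k
    refine le_of_eq ?_
    have : N ^ k = 2 ^ k * L ^ k := by rw [hN, mul_pow]
    rw [pow_succ L k, pow_succ N k, pow_mul', this, inv_pow]
    field_simp

/-- Supplies test `hB` for both weights used below, as each satisfies `w(y) Φ₂(Φ₁⁻¹(1/y)) ≲ y⁻²`. -/
theorem lintegral_weight_Ioi_le (hΦ : ClassU Φ₁) {L : ℝ≥0} (hL : 1 < L)
    (h : ∀ v, 0 < v → 2 * L * Φ₁ v ≤ Φ₁ (L * v)) {w : ℝ → ℝ≥0} {A : ℝ≥0}
    (hw : ∀ y : ℝ, 0 < y → w y * Φ₂ (inv Φ₁ (1 / y.toNNReal)) ≤ A / y.toNNReal ^ 2)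
    (v : ℝ≥0) (hv : 0 < v) :
    v * ∫⁻ y in Ioi ((1 / Φ₁ v : ℝ≥0) : ℝ),
      (w y * (Φ₂ (inv Φ₁ (1 / y.toNNReal)) / inv Φ₁ (1 / y.toNNReal)) : ℝ≥0) ≤
        (A * (4 * L ^ 2) * Φ₁ v : ℝ≥0) := by
  have h1 : ∫⁻ y in Ioi ((1 / Φ₁ v : ℝ≥0) : ℝ),
      ((w y * (Φ₂ (inv Φ₁ (1 / y.toNNReal)) / inv Φ₁ (1 / y.toNNReal)) : ℝ≥0) : ℝ≥0∞) ≤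
      A * ∫⁻ y in Ioi ((1 / Φ₁ v : ℝ≥0) : ℝ),
        ((1 / (y.toNNReal ^ 2 * inv Φ₁ (1 / y.toNNReal)) : ℝ≥0) : ℝ≥0∞) := by
    rw [← lintegral_const_mul' _ _ ENNReal.coe_ne_top]
    refine setLIntegral_mono' measurableSet_Ioi fun y hy => ?_
    rw [← ENNReal.coe_mul]
    refine ENNReal.coe_le_coe.2 ?_
    have hy0 : 0 < y := (NNReal.coe_nonneg _).trans_lt hy
    rw [← mul_div_assoc]
    calc _ ≤ A / y.toNNReal ^ 2 / inv Φ₁ (1 / y.toNNReal) := by gcongr; exact hw y hy0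
      _ = _ := by rw [div_div, mul_one_div]
  refine (mul_le_mul_right h1 _).trans ?_
  rw [mul_left_comm, mul_assoc, ENNReal.coe_mul]
  exact mul_le_mul_right (lintegral_Ioi_le_of_two_mul_le hΦ hL h hv) _

theorem lintegral_rpow_Ioc (hα : -1 < α) (h : ℝ≥0) :
    ∫⁻ y in Ioc (0 : ℝ) h, ((y.toNNReal ^ α : ℝ≥0) : ℝ≥0∞) =
      (h ^ (α + 1) / (α + 1).toNNReal : ℝ≥0) := by
  have h0 : (0 : ℝ) ≤ h := h.2
  have hα1 : 0 < α + 1 := by linarith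
  have e : ∫⁻ y in Ioc (0 : ℝ) h, ((y.toNNReal ^ α : ℝ≥0) : ℝ≥0∞) =
      ∫⁻ y in Ioc (0 : ℝ) h, ENNReal.ofReal (y ^ α) := by
    refine setLIntegral_congr_fun measurableSet_Ioc fun y hy => ?_
    rw [ENNReal.ofReal, Real.toNNReal_rpow_of_nonneg hy.1.le]
  rw [e, ← ofReal_integral_eq_lintegral_ofReal, ← intervalIntegral.integral_of_le h0,
    integral_rpow (Or.inl hα), Real.zero_rpow hα1.ne', sub_zero, ← ENNReal.ofReal_coe_nnreal]
  · push_cast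
    rw [Real.coe_toNNReal _ hα1.le]
  · exact (intervalIntegrable_iff_integrableOn_Ioc_of_le h0).1
      (intervalIntegral.intervalIntegrable_rpow' hα)
  · filter_upwards [ae_restrict_mem measurableSet_Ioc] with y hy
    exact Real.rpow_nonneg hy.1.le _

end Integrals

/-! ### Bounded and weighted-bounded functions as multipliers. -/

section Sufficiency

open Complex

variable {Φ₁ Φ₂ : ℝ≥0 → ℝ≥0} {α : ℝ}

theorem mem_multipliers_of_weight (h₁ : ClassU Φ₁) (h₂ : ClassU Φ₂)
    {w : ℝ → ℝ≥0} (hw : Measurable w) {A B D : ℝ≥0}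
    (hA : ∀ v : ℝ≥0, 0 < v → Φ₂ v * ∫⁻ y in Ioc (0 : ℝ) (1 / Φ₁ v : ℝ≥0), w y ≤ (A * Φ₁ v : ℝ≥0))
    (hB : ∀ v : ℝ≥0, 0 < v → v * ∫⁻ y in Ioi ((1 / Φ₁ v : ℝ≥0) : ℝ),
      (w y * (Φ₂ (inv Φ₁ (1 / y.toNNReal)) / inv Φ₁ (1 / y.toNNReal)) : ℝ≥0) ≤
        (B * Φ₁ v : ℝ≥0))
    {g : ℂ → ℂ} (hg : Holo g) (hgw : ∀ z ∈ upperHalf, ∀ s : ℝ≥0,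
      z.im.toNNReal ^ α * Φ₂ (s * ‖g z‖₊) ≤ D * (w z.im * Φ₂ (s / 2))) :
    g ∈ hardyBergmanMultipliers Φ₁ Φ₂ α := by
  have key : ∀ f ∈ hardySpace Φ₁, ∀ l : ℝ≥0, hardyNorm Φ₁ f < l →
      ∫⁻ z, (Φ₂ (‖f z * g z‖₊ / l) : ℝ≥0∞) ∂(V α) ≤ (D * (A + B) : ℝ≥0) := by
    intro f hf l hl
    -- The values of `f` off the half-plane are arbitrary; cutting them off ensures measurability.
    have hfm : Measurable (upperHalf.indicator f) := by
      classical
      rw [← piecewise_eq_indicator]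
      exact hf.1.continuousOn.measurable_piecewise continuousOn_const
        isOpen_upperHalf.measurableSet
    set F : ℂ → ℂ := fun z => upperHalf.indicator f z / (l : ℝ) with hF
    have hFn : ∀ z ∈ upperHalf, ‖F z‖₊ = ‖f z‖₊ / l := fun z hz => by
      rw [hF]; simp only; rw [indicator_of_mem hz, nnnorm_div]; congr 1; ext; simp
    have hemb := setLIntegral_weight_mul_map_half_le h₁ h₂ hw hA hB (f := F)
      (hfm.div_const _) ((hf.1.congr fun z hz => indicator_of_mem hz f).div_const _) ?_
    · rw [lintegral_V, ENNReal.coe_mul]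
      refine le_trans ?_ (mul_le_mul_right hemb _)
      rw [← lintegral_const_mul' _ _ ENNReal.coe_ne_top]
      refine setLIntegral_mono' isOpen_upperHalf.measurableSet fun z hz => ?_
      have hz0 : 0 < z.im := hz
      have := hgw z hz (‖f z‖₊ / l)
      rw [← hFn z hz] at this
      have e : ‖f z * g z‖₊ / l = ‖F z‖₊ * ‖g z‖₊ := by
        rw [hFn z hz, nnnorm_mul]; ring
      rw [e, ENNReal.ofReal, Real.toNNReal_rpow_of_nonneg hz0.le]
      exact_mod_cast this
    · intro y hy
      have hlt : lux Φ₁ volume (fun x : ℝ => f (x + y * I)) < l :=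
        (le_iSup₂ (f := fun (y : ℝ) (_ : 0 < y) =>
          lux Φ₁ volume (fun x : ℝ => f (x + y * I))) y hy).trans_lt hl
      refine le_trans (le_of_eq ?_) (lintegral_le_one_of_lux_lt h₁.monotone hlt)
      refine lintegral_congr fun x => ?_
      rw [hFn _ (by simpa [upperHalf] using hy)]
  -- Enlarging the scale from `l` to `l E` divides the modular by at least `E`, which brings it
  -- below 1.
  set E : ℝ≥0 := max 1 (D * (A + B)) with hE
  have hE1 : 1 ≤ E := le_max_left _ _
  have hE0 : 0 < E := one_pos.trans_le hE1
  have hDE : (D * (A + B) : ℝ≥0) ≤ (E : ℝ≥0∞) := ENNReal.coe_le_coe.2 (le_max_right _ _)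
  refine ⟨hg, E, hE0, fun f hf => ⟨⟨hf.1.mul hg, ?_⟩, ?_⟩⟩
  · obtain ⟨l, hl1, -⟩ := ENNReal.lt_iff_exists_nnreal_btwn.1 hf.2
    obtain ⟨C, -, hC⟩ := h₂.exists_map_mul_le l
    have hl0 : l ≠ 0 := by
      rintro rfl; exact absurd hl1 not_lt_zero
    calc ∫⁻ z, (Φ₂ ‖f z * g z‖₊ : ℝ≥0∞) ∂(V α)
        ≤ ∫⁻ z, (C : ℝ≥0∞) * Φ₂ (‖f z * g z‖₊ / l) ∂(V α) := by
          refine lintegral_mono fun z => ?_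
          have := hC (‖f z * g z‖₊ / l)
          rw [mul_div_cancel₀ _ hl0] at this
          rw [← ENNReal.coe_mul]
          exact ENNReal.coe_le_coe.2 this
      _ = C * ∫⁻ z, (Φ₂ (‖f z * g z‖₊ / l) : ℝ≥0∞) ∂(V α) :=
          lintegral_const_mul' _ _ ENNReal.coe_ne_top
      _ ≤ C * (D * (A + B) : ℝ≥0) := mul_le_mul_right (key f hf l hl1) _
      _ < ∞ := by rw [← ENNReal.coe_mul]; exact ENNReal.coe_lt_top
  · have hle : ∀ l : ℝ≥0, hardyNorm Φ₁ f < l →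
        bergmanNorm Φ₂ α (fun z => f z * g z) ≤ (l * E : ℝ≥0) := by
      intro l hl
      have hl0 : 0 < l := by
        rw [pos_iff_ne_zero]; rintro rfl; exact absurd hl not_lt_zero
      refine lux_le (mul_pos hl0 hE0) ?_
      calc ∫⁻ z, (Φ₂ (‖f z * g z‖₊ / (l * E)) : ℝ≥0∞) ∂(V α)
          ≤ ∫⁻ z, ((E⁻¹ : ℝ≥0) : ℝ≥0∞) * Φ₂ (‖f z * g z‖₊ / l) ∂(V α) := by
            refine lintegral_mono fun z => ?_
            have := h₂.map_mul_le (inv_le_one_of_one_le₀ hE1) (‖f z * g z‖₊ / l)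
            rw [inv_mul_eq_div, div_div] at this
            rw [← ENNReal.coe_mul]
            exact ENNReal.coe_le_coe.2 this
        _ = ((E⁻¹ : ℝ≥0) : ℝ≥0∞) * ∫⁻ z, (Φ₂ (‖f z * g z‖₊ / l) : ℝ≥0∞) ∂(V α) :=
            lintegral_const_mul' _ _ ENNReal.coe_ne_top
        _ ≤ ((E⁻¹ : ℝ≥0) : ℝ≥0∞) * E := mul_le_mul_right ((key f hf l hl).trans hDE) _
        _ = 1 := by rw [← ENNReal.coe_mul, inv_mul_cancel₀ hE0.ne', ENNReal.coe_one]
    obtain ⟨n, hn⟩ : ∃ n : ℝ≥0, (n : ℝ≥0∞) = hardyNorm Φ₁ f :=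
      ⟨_, ENNReal.coe_toNNReal hf.2.ne⟩
    rw [← hn]
    refine ENNReal.le_of_forall_pos_le_add fun ε hε _ => ?_
    refine (hle (n + ε / E) (by
      rw [← hn, ENNReal.coe_lt_coe]; exact lt_add_of_pos_right _ (by positivity))).trans_eq ?_
    rw [← ENNReal.coe_mul, ← ENNReal.coe_add]
    congr 1
    field_simp

/-- The lower bound on `ω` says `Φ₂(Φ₁⁻¹(1/t)) ≲ t^{-(2+α)}`, and this gives both tests for the
weight `y^α`. -/
theorem hInfty_subset_multipliers (h₁ : ClassU Φ₁) (h₂ : ClassU Φ₂) (hα : -1 < α)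
    (hn : Nabla2 Φ₁) {c : ℝ≥0} (hc0 : 0 < c)
    (hc : ∀ t : ℝ≥0, 0 < t → c ≤ weight Φ₁ Φ₂ α t) :
    hInfty ⊆ hardyBergmanMultipliers Φ₁ Φ₂ α := by
  rintro g ⟨hg, M, hM⟩
  obtain ⟨L, hL, hL2⟩ := exists_two_mul_le_of_delta2_complementary h₁.monotone_div hn.2
  obtain ⟨K, hK1, hK⟩ := h₂.exists_map_mul_le c⁻¹
  obtain ⟨D, hD1, hD⟩ := h₂.exists_map_mul_le (2 * M.toNNReal)
  have hα1 : 0 < (α + 1).toNNReal := Real.toNNReal_pos.2 (by linarith)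
  have hcomp : ∀ t : ℝ≥0, 0 < t → Φ₂ (inv Φ₁ (1 / t)) ≤ K / t ^ (2 + α) := by
    intro t ht
    have h := hc t ht
    rw [weight, le_div_iff₀ (h₁.inv_pos (one_div_pos.2 ht))] at h
    have h' : inv Φ₁ (1 / t) ≤ c⁻¹ * inv Φ₂ (1 / t ^ (2 + α)) := by
      rw [le_inv_mul_iff₀ hc0]; exact h
    refine (h₂.monotone h').trans ((hK _).trans_eq ?_)
    rw [h₂.map_inv, mul_one_div]
  refine mem_multipliers_of_weight h₁ h₂ (w := fun y => y.toNNReal ^ α) (by fun_prop)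
    (A := K / (α + 1).toNNReal) (D := D) ?_ (lintegral_weight_Ioi_le h₁ hL hL2 (A := K) ?_) hg ?_
  · intro v hv
    have hV := h₁.map_pos hv
    rw [lintegral_rpow_Ioc hα, ← ENNReal.coe_mul]
    refine ENNReal.coe_le_coe.2 ?_
    have h := hcomp (1 / Φ₁ v) (one_div_pos.2 hV)
    rw [one_div_one_div, h₁.inv_map] at h
    have e : (1 / Φ₁ v) ^ (2 + α) = (1 / Φ₁ v) ^ (α + 1) * (1 / Φ₁ v) := by
      rw [show 2 + α = α + 1 + 1 by ring, NNReal.rpow_add_one (one_div_pos.2 hV).ne']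
    have hpos : 0 < (1 / Φ₁ v) ^ (α + 1) := NNReal.rpow_pos (one_div_pos.2 hV)
    rw [e] at h
    calc _ ≤ K / ((1 / Φ₁ v) ^ (α + 1) * (1 / Φ₁ v)) * ((1 / Φ₁ v) ^ (α + 1) / (α + 1).toNNReal) := by
          gcongr
      _ = _ := by
          generalize (1 / Φ₁ v) ^ (α + 1) = X at hpos
          field_simp
  · intro y hy
    have hy0 : 0 < y.toNNReal := Real.toNNReal_pos.2 hy
    refine (mul_le_mul_right (hcomp _ hy0) _).trans_eq ?_
    rw [NNReal.rpow_add hy0.ne', show (2 : ℝ) = ((2 : ℕ) : ℝ) by norm_num, NNReal.rpow_natCast]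
    have : 0 < y.toNNReal ^ α := NNReal.rpow_pos hy0
    field_simp
  · intro z hz s
    rw [mul_left_comm]
    refine mul_le_mul_right ?_ _
    refine (h₂.monotone ?_).trans (hD (s / 2))
    have : ‖g z‖₊ ≤ M.toNNReal := by
      rw [← norm_toNNReal]; exact Real.toNNReal_le_toNNReal (hM z hz)
    calc s * ‖g z‖₊ ≤ s * M.toNNReal := by gcongr
      _ = _ := by field_simp

/-- For `Φ ∈ 𝒰̃` the reverse quotient inequality holds along the weight `ω`. -/
theorem exists_map_weight_le (h₁ : ClassU Φ₁) (h₂ : ClassUTilde Φ₂) (hα : -1 < α)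
    (hω : AntitoneOn (weight Φ₁ Φ₂ α) (Ioi 0)) :
    ∃ K : ℝ≥0, ∀ t : ℝ≥0, 0 < t →
      Φ₂ (weight Φ₁ Φ₂ α t) ≤ K * (1 / t ^ (2 + α) / Φ₂ (inv Φ₁ (1 / t))) := by
  have hU := h₂.classU
  obtain ⟨q, hq, -, ⟨C₂, -, hC₂⟩, ⟨C₃, -, hC₃⟩⟩ := h₂
  obtain ⟨C, hC0, hC⟩ := hq.upperType
  have hexp : 0 ≤ 2 + α := by linarith
  set a : ℝ≥0 → ℝ≥0 := fun t => inv Φ₂ (1 / t ^ (2 + α)) with ha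
  set b : ℝ≥0 → ℝ≥0 := fun t => inv Φ₁ (1 / t) with hb
  have ha0 : ∀ t, 0 < t → 0 < a t := fun t ht => hU.inv_pos (by positivity)
  have hb0 : ∀ t, 0 < t → 0 < b t := fun t ht => h₁.inv_pos (by positivity)
  have hanti : ∀ s t, 0 < s → s ≤ t → a t ≤ a s := fun s t hs hst => hU.inv_mono (by gcongr)
  have hbnti : ∀ s t, 0 < s → s ≤ t → b t ≤ b s := fun s t hs hst => h₁.inv_mono (by gcongr)
  have hΦa : ∀ t, Φ₂ (a t) = 1 / t ^ (2 + α) := fun t => hU.map_inv _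
  have hΦb0 : ∀ t, 0 < t → 0 < Φ₂ (b t) := fun t ht => hU.map_pos (hb0 t ht)
  have hweight : ∀ t, weight Φ₁ Φ₂ α t = a t / b t := fun t => rfl
  -- small `t`
  set m : ℝ≥0 := min (min (a 1) (b 1)) 1 with hm
  -- Both `a` and `b` are nonincreasing, so for `t ≤ 1` dividing by `m` makes them at least 1 and
  -- keeps their quotient, as the second condition of `𝒰̃` demands. Upper type based at 1 then
  -- trades `b^q` for `Φ₂(b)`.
  have hm0 : 0 < m := lt_min (lt_min (ha0 1 one_pos) (hb0 1 one_pos)) one_pos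
  have hm1 : m ≤ 1 := min_le_right _ _
  obtain ⟨Km, hKm1, hKm⟩ := hU.exists_map_mul_le m⁻¹
  have hsmall : ∀ t, 0 < t → t ≤ 1 →
      Φ₂ (a t / b t) ≤ C₂ * Km * (C * Φ₂ 1) * (Φ₂ (a t) / Φ₂ (b t)) := by
    intro t ht ht1
    have ha1 : 1 ≤ m⁻¹ * a t := by
      rw [le_inv_mul_iff₀ hm0, mul_one]
      exact ((min_le_left _ _).trans (min_le_left _ _)).trans (hanti t 1 ht ht1)
    have hb1 : 1 ≤ m⁻¹ * b t := by
      rw [le_inv_mul_iff₀ hm0, mul_one]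
      exact ((min_le_left _ _).trans (min_le_right _ _)).trans (hbnti t 1 ht ht1)
    have h1 := hC₂ _ _ ha1 hb1
    rw [mul_div_mul_left _ _ (inv_pos.2 hm0).ne'] at h1
    have h2 : Φ₂ (b t) ≤ C * (m⁻¹ * b t) ^ q * Φ₂ 1 := by
      have := hC 1 _ one_pos hb1
      rw [one_mul] at this
      refine (hU.monotone ?_).trans this
      calc b t = 1 * b t := (one_mul _).symm
        _ ≤ _ := mul_le_mul_left ((one_le_inv₀ hm0).2 hm1) _
    have hX : 0 < (m⁻¹ * b t) ^ q := NNReal.rpow_pos (one_pos.trans_le hb1)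
    generalize (m⁻¹ * b t) ^ q = X at h1 h2 hX
    have hbt := hΦb0 t ht
    have h3 : 1 / X ≤ C * Φ₂ 1 / Φ₂ (b t) := by
      rw [div_le_div_iff₀ hX hbt, one_mul]
      refine h2.trans_eq (by ring)
    calc Φ₂ (a t / b t) ≤ C₂ * (Φ₂ (m⁻¹ * a t) / X) := h1
      _ = C₂ * (Φ₂ (m⁻¹ * a t) * (1 / X)) := by rw [mul_one_div]
      _ ≤ C₂ * (Km * Φ₂ (a t) * (C * Φ₂ 1 / Φ₂ (b t))) := by
          gcongr
          exact hKm _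
      _ = _ := by ring
  -- large `t`
  set P : ℝ≥0 := max (b 1) 1 with hP
  -- For `t ≥ 1`, dividing by `P` puts `b` below 1. Since `ω(t) ≤ ω(1) ≤ S`, dividing `a` by `P S`
  -- puts it below `b / P`, so the third condition of `𝒰̃` applies.
  have hP1 : 1 ≤ P := le_max_right _ _
  have hP0 : 0 < P := one_pos.trans_le hP1
  set S : ℝ≥0 := max (weight Φ₁ Φ₂ α 1) 1 with hS
  have hS1 : 1 ≤ S := le_max_right _ _
  have hS0 : 0 < S := one_pos.trans_le hS1
  obtain ⟨KS, hKS1, hKS⟩ := hU.exists_map_mul_le S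
  obtain ⟨KP, hKP1, hKP⟩ := hU.exists_map_mul_le P
  have hlarge : ∀ t, 0 < t → 1 ≤ t →
      Φ₂ (a t / b t) ≤ KS * C₃ * KP * (Φ₂ (a t) / Φ₂ (b t)) := by
    intro t ht ht1
    have hat := ha0 t ht
    have hbt := hb0 t ht
    have hb' : b t / P ≤ 1 := by
      rw [div_le_one hP0]
      exact (hbnti 1 t one_pos ht1).trans (le_max_left _ _)
    have hab : a t / (P * S) ≤ b t / P := by
      have hw : a t / b t ≤ S := by
        rw [← hweight]
        exact (hω (mem_Ioi.2 (zero_lt_one' ℝ≥0)) ht ht1).trans (le_max_left _ _)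
      rw [div_le_iff₀ hbt] at hw
      rw [div_le_div_iff₀ (by positivity) hP0]
      calc a t * P ≤ S * b t * P := by gcongr
        _ = _ := by ring
    have h1 := hC₃ _ _ (by positivity) hab hb'
    have h2 : Φ₂ (b t) ≤ KP * Φ₂ (b t / P) := by
      have := hKP (b t / P)
      rwa [mul_div_cancel₀ _ hP0.ne'] at this
    have h3 : Φ₂ (a t / (P * S)) ≤ Φ₂ (a t) :=
      hU.monotone (div_le_self zero_le (one_le_mul hP1 hS1))
    have hb3 : 0 < Φ₂ (b t / P) := hU.map_pos (by positivity)
    have hb4 := hΦb0 t ht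
    calc Φ₂ (a t / b t) = Φ₂ (S * (a t / (P * S) / (b t / P))) := by congr 1; field_simp
      _ ≤ KS * Φ₂ (a t / (P * S) / (b t / P)) := hKS _
      _ ≤ KS * (C₃ * (Φ₂ (a t / (P * S)) / Φ₂ (b t / P))) := by gcongr
      _ ≤ KS * (C₃ * (Φ₂ (a t) / (Φ₂ (b t) / KP))) := by
          gcongr
          rw [div_le_iff₀' (one_pos.trans_le hKP1)]
          exact h2
      _ = _ := by
          have : 0 < KP := one_pos.trans_le hKP1
          field_simp
  refine ⟨max (C₂ * Km * (C * Φ₂ 1)) (KS * C₃ * KP), fun t ht => ?_⟩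
  rw [hweight, ← hΦa]
  rcases le_total t 1 with h | h
  · exact (hsmall t ht h).trans (mul_le_mul_left (le_max_left _ _) _)
  · exact (hlarge t ht h).trans (mul_le_mul_left (le_max_right _ _) _)

theorem hInftyWeighted_subset_multipliers (h₁ : ClassU Φ₁) (h₂ : ClassUTilde Φ₂)
    (hquot : MonotoneOn (fun t : ℝ≥0 => Φ₂ t / Φ₁ t) (Ioi 0)) (hα : -1 < α)
    (hn₁ : Nabla2 Φ₁) (hn₃ : Nabla2 (Φ₂ ∘ inv Φ₁))
    (hω : AntitoneOn (weight Φ₁ Φ₂ α) (Ioi 0)) :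
    hInftyWeighted (weight Φ₁ Φ₂ α) ⊆ hardyBergmanMultipliers Φ₁ Φ₂ α := by
  rintro g ⟨hg, M, hM⟩
  have hU := h₂.classU
  have hG : MonotoneOn (fun t => (Φ₂ ∘ inv Φ₁) t / t) (Ioi 0) := by
    intro s hs t ht hst
    have := hquot (h₁.inv_pos hs) (h₁.inv_pos ht) (h₁.inv_mono hst)
    simp only [h₁.map_inv] at this
    exact this
  have hGpos : ∀ t, 0 < t → 0 < (Φ₂ ∘ inv Φ₁) t := fun t ht => hU.map_pos (h₁.inv_pos ht)
  obtain ⟨L, hL, hL2⟩ := exists_two_mul_le_of_delta2_complementary h₁.monotone_div hn₁.2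
  obtain ⟨N, hN, hN2⟩ := exists_two_mul_le_of_delta2_complementary hG hn₃.2
  obtain ⟨K, hK⟩ := exists_map_weight_le h₁ h₂ hα hω
  obtain ⟨D, hD1, hD⟩ := hU.exists_map_mul_le (2 * M.toNNReal)
  obtain ⟨-, -, ⟨C₁, -, hC₁⟩, -, -⟩ := h₂
  refine mem_multipliers_of_weight h₁ hU
    -- Up to constants, this is the bound for `y^α Φ₂(ω(y))` given by `exists_map_weight_le`. Its
    -- test near 0 is the `∇₂`-condition on `Φ₂ ∘ Φ₁⁻¹`.
    (w := fun y => 1 / (y.toNNReal ^ 2 * (Φ₂ ∘ inv Φ₁) (1 / y.toNNReal))) ?_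
    (A := 2 * N) (D := C₁ * D * K) ?_ (lintegral_weight_Ioi_le h₁ hL hL2 (A := 1) ?_) hg ?_
  · have : Measurable fun y : ℝ => (Φ₂ ∘ inv Φ₁) (1 / y.toNNReal) :=
      (hU.measurable.comp (measurable_inv h₁)).comp (by fun_prop)
    exact measurable_const.div (Measurable.mul (by fun_prop) this)
  · intro v hv
    have := lintegral_Ioc_le_of_two_mul_le hG hGpos hN hN2 (h₁.map_pos hv)
    rwa [Function.comp_apply, h₁.inv_map] at this
  · intro y hy
    have hy0 : 0 < y.toNNReal := Real.toNNReal_pos.2 hy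
    have := hGpos _ (one_div_pos.2 hy0)
    rw [Function.comp_apply] at this ⊢
    refine le_of_eq ?_
    field_simp
  · intro z hz s
    have hz0 : 0 < z.im := hz
    set t := z.im.toNNReal with ht
    have ht0 : 0 < t := Real.toNNReal_pos.2 hz
    have hω0 : 0 < weight Φ₁ Φ₂ α t := weight_pos h₁ hU ht0
    have hgle : ‖g z‖₊ ≤ M.toNNReal * weight Φ₁ Φ₂ α t := by
      have h := hM z hz
      rw [div_le_iff₀ (NNReal.coe_pos.2 hω0)] at h
      rw [← NNReal.coe_le_coe, coe_nnnorm, NNReal.coe_mul]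
      exact h.trans (mul_le_mul_of_nonneg_right (Real.le_coe_toNNReal _) (NNReal.coe_nonneg _))
    have hsub : Φ₂ (s * ‖g z‖₊) ≤ C₁ * (D * Φ₂ (s / 2)) * Φ₂ (weight Φ₁ Φ₂ α t) := by
      -- Submultiplicativity is available only for positive arguments.
      rcases eq_or_ne (s * M.toNNReal) 0 with h0 | h0
      · have : s * ‖g z‖₊ = 0 := le_antisymm (by
          calc s * ‖g z‖₊ ≤ s * (M.toNNReal * weight Φ₁ Φ₂ α t) := by gcongr
            _ = 0 := by rw [← mul_assoc, h0, zero_mul]) zero_le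
        rw [this, hU.map_zero]; exact zero_le
      · calc Φ₂ (s * ‖g z‖₊) ≤ Φ₂ (s * M.toNNReal * weight Φ₁ Φ₂ α t) := by
              rw [mul_assoc]; exact hU.monotone (by gcongr)
          _ ≤ C₁ * Φ₂ (s * M.toNNReal) * Φ₂ (weight Φ₁ Φ₂ α t) :=
              hC₁ _ _ (pos_iff_ne_zero.2 h0) hω0
          _ ≤ _ := by
              gcongr
              refine le_trans (le_of_eq ?_) (hD (s / 2))
              congr 1; field_simp
    have hb0 := hGpos _ (one_div_pos.2 ht0)
    rw [Function.comp_apply] at hb0 ⊢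
    calc t ^ α * Φ₂ (s * ‖g z‖₊)
        ≤ t ^ α * (C₁ * (D * Φ₂ (s / 2)) * (K * (1 / t ^ (2 + α) / Φ₂ (inv Φ₁ (1 / t))))) := by
          gcongr
          exact hsub.trans (mul_le_mul_right (hK t ht0) _)
      _ = _ := by
          rw [NNReal.rpow_add ht0.ne', show (2 : ℝ) = ((2 : ℕ) : ℝ) by norm_num,
            NNReal.rpow_natCast]
          have : 0 < t ^ α := NNReal.rpow_pos ht0
          field_simp

end Sufficiency

end OrliczHalfPlane

theorem theorem2p7 (Φ₁ Φ₂ : ℝ≥0 → ℝ≥0) (hΦ₁ : ClassU Φ₁) (hΦ₂ : ClassUTilde Φ₂)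
    (hquot : MonotoneOn (fun t : ℝ≥0 => Φ₂ t / Φ₁ t) (Ioi 0))
    (α : ℝ) (hα : -1 < α) :
    (Nabla2 Φ₁ →
      (∃ c C : ℝ≥0, 0 < c ∧ 0 < C ∧
        ∀ t : ℝ≥0, 0 < t → c ≤ weight Φ₁ Φ₂ α t ∧ weight Φ₁ Φ₂ α t ≤ C) →
      hardyBergmanMultipliers Φ₁ Φ₂ α = hInfty) ∧
    (MonotoneOn (weight Φ₁ Φ₂ α) (Ioi 0) →
      Tendsto (weight Φ₁ Φ₂ α) (𝓝[>] 0) (𝓝 0) →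
      hardyBergmanMultipliers Φ₁ Φ₂ α = zeroSpace) ∧
    (Nabla2 Φ₁ → Nabla2 (Φ₂ ∘ OrliczHalfPlane.inv Φ₁) →
      AntitoneOn (weight Φ₁ Φ₂ α) (Ioi 0) →
      hardyBergmanMultipliers Φ₁ Φ₂ α = hInftyWeighted (weight Φ₁ Φ₂ α)) := by
  have hU := hΦ₂.classU
  refine ⟨?_, fun hm hl => ?_, fun hn₁ hn₃ hω => ?_⟩
  · rintro hn ⟨c, C, hc, -, h⟩
    exact (multipliers_subset_hInfty hΦ₁ hU fun t ht => (h t ht).2).antisymm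
      (hInfty_subset_multipliers hΦ₁ hU hα hn hc fun t ht => (h t ht).1)
  · exact (multipliers_subset_zeroSpace hΦ₁ hU hm hl).antisymm (zeroSpace_subset_multipliers hU)
  · exact (multipliers_subset_hInftyWeighted hΦ₁ hU).antisymm
      (hInftyWeighted_subset_multipliers hΦ₁ hΦ₂ hquot hα hn₁ hn₃ hω)
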